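/- **Setting.** Throughout, $\mathbb{R}^q$ carries the $\ell_1$ norm $\|\cdot\|$, with closed unit ball $B_1(0)$ and Hausdorff distance $d_H$; $\operatorname{cone}A$ is the convex conic hull ($\operatorname{cone}\emptyset=\{0\}$), $A^+$ the positive dual cone of $A$, and $A_\infty=\{d \mid y+\alpha d\in A\ \forall y\in A,\alpha\ge 0\}$ the recession cone. Consider the problem $$\text{(P)}\qquad \text{minimize }\Gamma(x)\text{ with respect to }\le_C\text{ subject to }x\in\mathcal X ,$$ where $\mathcal X\subseteq\mathbb{R}^n$ is closed and convex with nonempty interior (so (P) is feasible), $C\subseteq\mathbb{R}^q$ is a closed, convex, pointed, solid, non-trivial, polyhedral cone, and $\Gamma:\mathcal X\to\mathbb{R}^q$ is continuous and $C$-convex. Let $\mathcal P=\operatorname{cl}(\Gamma(\mathcal X)+C)$ be the upper image. Fix $c\in\operatorname{int}C$ with $\|c\|=1$, a finite set $R$ of generators of $C$ with $\|d\|=1$ for $d\in R$, a finite set $R^*$ of generators of $C^+$ with $c^{\mathsf T}z=1$ for $z\in R^*$, and tolerances $\varepsilon,\delta>0$. **Scalarizations.** $\mathrm P_1(w)$: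 minimize $w^{\mathsf T}\Gamma(x)$ subject to $x\in\mathcal X$. $\mathrm P_2(v,d)$, for $d\neq 0$: maximize $z$ subject to $x\in\mathcal X$, $z\in\mathbb{R}$, $\Gamma(x)\le_C v+zd$. $\mathrm D_2(v,d)$: minimize $\sup_{x\in\mathcal X}\{-w^{\mathsf T}\Gamma(x)\}+w^{\mathsf T}v$ subject to $w^{\mathsf T}d=-1$, $w\in C^+$. Write $H(w,x)=\{y\mid w^{\mathsf T}(y-\Gamma(x))\ge 0\}$. **Phase 1.** Start with $\mathcal Y_{In}=R$, $\hat C=\emptyset$, $\mathcal P_0=\mathbb{R}^q$, $\bar{\mathcal X}=\emptyset$. Choose $x_0\in\mathcal X$ and put $v=\Gamma(x_0)+\sum_{d\in R}d$. 1. For every $z\in R^*$: either $\mathrm P_1(z)$ is unbounded, or an optimal solution $x^*$ is found, $x^*$ is added to $\bar{\mathcal X}$ and $\mathcal P_0$ is replaced by $\mathcal P_0\cap H(z,x^*)$. If no $\mathrm P_1(z)$ was unbounded, set $\mathcal Y_{Out}=R$ and end Phase 1. 2. For every $d\in -R$: either $\mathrm P_2(v,d)$ is unbounded and $d$ is added to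 $\mathcal Y_{In}$, or optimal solutions $(x,z)$ of $\mathrm P_2(v,d)$ and $w$ of $\mathrm D_2(v,d)$ are found, $x$ is added to $\bar{\mathcal X}$ and $\mathcal P_0$ is replaced by $\mathcal P_0\cap H(w,x)$. Then let $\mathcal Y_{Out}$ be the set of nonzero vertices of $(\mathcal P_0)_\infty\cap B_1(0)$. 3. While $\mathcal Y_{Out}\setminus(\mathcal Y_{In}\cup\hat C)\ne\emptyset$: take $d$ in it and $\tilde r\in\mathcal Y_{In}$ minimizing $\|d-r\|$ over $r\in\mathcal Y_{In}$. If $\|d-\tilde r\|\le\delta$, add $d$ to $\hat C$. Otherwise choose $\lambda\in(0,1)$ with $u=\lambda d+(1-\lambda)\tilde r\neq0$; either $\mathrm P_2(v,u)$ is unbounded and $u/\|u\|$ is added to $\mathcal Y_{In}$, or optimal solutions $(x,z)$ of $\mathrm P_2(v,u)$ and $w$ of $\mathrm D_2(v,u)$ are found, $x$ is added to $\bar{\mathcal X}$, $\mathcal P_0$ is replaced by $\mathcal P_0\cap H(w,x)$, and $\mathcal Y_{Out}$ is recomputed as the set of nonzero vertices of $(\mathcal P_0)_\infty\cap B_1(0)$.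 **Phase 2.** Start with $k=0$ and repeat the following round. Set $M=\mathbb{R}^q$ and compute a set $\mathcal P^V$ of vertices of $\mathcal P_k$, that is, either the set of its extreme points, if there are any, or the finite nonempty set of points of some generator representation $\mathcal P_k=\operatorname{conv}\mathcal P^V+\operatorname{cone}K$ with $K$ finite. For every $v\in\mathcal P^V$ find optimal solutions $(x^v,z^v)$ of $\mathrm P_2(v,-c)$ and $w^v$ of $\mathrm D_2(v,-c)$, add $x^v$ to $\bar{\mathcal X}$, and, if $-z^v>\varepsilon$, replace $M$ by $M\cap H(w^v,x^v)$. If $M=\mathbb{R}^q$, stop; otherwise set $\mathcal P_{k+1}=\mathcal P_k\cap M$, increase $k$ by one and do another round. The output is $(\bar{\mathcal X},\mathcal Y_{Out})$. The algorithm *terminates* if, for some choices made as above, all the solutions asked for exist and the end of Phase 2 is reached after finitely many steps. **Theorem.** If the algorithm terminates with output $(\bar{\mathcal X},\mathcal Y_{Out})$, then this pair is a finite weak $(\varepsilon,\delta)$-solution of (P), that is: * $\bar{\mathcal X}$ and $\mathcal Y_{Out}$ are finite, and $\bar{\mathcal X}\neq\emptyset$; * every $\bar x\in\bar{\mathcal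 X}$ is a weak minimizer: $\bar x\in\mathcal X$ and $(\{\Gamma(\bar x)\}-\operatorname{int}C)\cap\Gamma(\mathcal X)=\emptyset$; * $\mathcal Y_{Out}$ is a $\delta$-outer approximation of $\mathcal P_\infty$: $\mathcal P_\infty\subseteq\operatorname{cone}\mathcal Y_{Out}$ and $d_H(\mathcal P_\infty\cap B_1(0),\operatorname{cone}\mathcal Y_{Out}\cap B_1(0))\le\delta$; * $\mathcal P\subseteq\operatorname{conv}\Gamma(\bar{\mathcal X})+\operatorname{cone}\mathcal Y_{Out}-\varepsilon\{c\}$. -/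

import Mathlib

open scoped Pointwise

/-- `ℝ^q` with the Manhattan norm `‖y‖ = ∑ i, |y i|`. -/
abbrev L1Space (q : ℕ) : Type := PiLp 1 (fun _ : Fin q => ℝ)

namespace L1Space

variable {q : ℕ}

/-- The standard scalar product `wᵀ y`. -/
noncomputable def dot (w y : L1Space q) : ℝ := ∑ i, w i * y i

/-- The convex conic hull, with `cone ∅ = {0}`. -/
def cone (A : Set (L1Space q)) : Set (L1Space q) := (PointedCone.hull ℝ A : Set (L1Space q))

/-- The positive dual cone `A⁺`. -/
def dualCone (A : Set (L1Space q)) : Set (L1Space q) := {z | ∀ y ∈ A, 0 ≤ dot z y}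

/-- The recession cone `A_∞`. -/
def recessionCone (A : Set (L1Space q)) : Set (L1Space q) :=
  {d | ∀ y ∈ A, ∀ α : ℝ, 0 ≤ α → y + α • d ∈ A}

/-- The halfspace `{y | wᵀ (y - p) ≥ 0}`. -/
def halfspace (w p : L1Space q) : Set (L1Space q) := {y | 0 ≤ dot w (y - p)}

/-- Polyhedral convex sets: those with an H-representation. -/
def IsPolyhedral (A : Set (L1Space q)) : Prop :=
  ∃ (r : ℕ) (w : Fin r → L1Space q) (γ : Fin r → ℝ),
    (∀ i, w i ≠ 0) ∧ A = {y | ∀ i, γ i ≤ dot (w i) y}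

/-- `V` is the set of points of a V-representation (generator representation)
`A = conv V + cone K`. -/
def IsGeneratorPoints (A : Set (L1Space q)) (V : Finset (L1Space q)) : Prop :=
  V.Nonempty ∧ ∃ K : Finset (L1Space q), (∀ k ∈ K, k ≠ 0) ∧
    A = convexHull ℝ (V : Set (L1Space q)) + cone (K : Set (L1Space q))

/-- `V` is a set of vertices of the polyhedron `A`: either the set of all extreme points of `A`,
if there are any, or the points of a generator representation of `A` (the only available meaning
for a polyhedron that contains a line and thus has no extreme point). -/
def IsVertexSet (A : Set (L1Space q)) (V : Finset (L1Space q)) : Prop :=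
  (V.Nonempty ∧ (V : Set (L1Space q)) = A.extremePoints ℝ) ∨ IsGeneratorPoints A V

/-- `vert (A_∞ ∩ B₁(0)) \ {0}`. -/
def outerDirections (A : Set (L1Space q)) : Set (L1Space q) :=
  (recessionCone A ∩ Metric.closedBall 0 1).extremePoints ℝ \ {0}

end L1Space

open L1Space

/-- `ForEach step S s s'`: starting in state `s`, the loop "for all `a ∈ S` do `step a`", executed
in some order, can end in state `s'`. -/
inductive ForEach {α σ : Type} (step : α → σ → σ → Prop) : Finset α → σ → σ → Prop
  | done (s : σ) : ForEach step ∅ s s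
  | next (a : α) (S : Finset α) (ha : a ∉ S) (s₁ s₂ s₃ : σ) :
      step a s₁ s₂ → ForEach step S s₂ s₃ → ForEach step (Finset.cons a S ha) s₁ s₃

/-- The data of the problem: minimize `Γ x` with respect to `≤_C` subject to `x ∈ X`.
Only the values of `Γ` on `X` matter. -/
structure CVOP (n q : ℕ) where
  X : Set (EuclideanSpace ℝ (Fin n))
  Γ : EuclideanSpace ℝ (Fin n) → L1Space q
  C : ConvexCone ℝ (L1Space q)

namespace CVOP

variable {n q : ℕ}

/-- `X` is closed and convex with nonempty interior; the ordering cone `C` is closed, non-trivial,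
pointed (contains no line), solid and polyhedral; `Γ` is continuous and `C`-convex on `X`. -/
structure Regular (P : CVOP n q) : Prop where
  closed_X : IsClosed P.X
  convex_X : Convex ℝ P.X
  interior_X : (interior P.X).Nonempty
  closed_C : IsClosed (P.C : Set (L1Space q))
  zero_ssubset_C : ({0} : Set (L1Space q)) ⊂ P.C
  C_ssubset_univ : (P.C : Set (L1Space q)) ⊂ Set.univ
  salient_C : P.C.Salient
  solid_C : (interior (P.C : Set (L1Space q))).Nonempty
  polyhedral_C : IsPolyhedral (P.C : Set (L1Space q))
  continuous_Γ : ContinuousOn P.Γ P.X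
  convex_Γ : ∀ x ∈ P.X, ∀ y ∈ P.X, ∀ α : ℝ, 0 ≤ α → α ≤ 1 →
    α • P.Γ x + (1 - α) • P.Γ y - P.Γ (α • x + (1 - α) • y) ∈ P.C

/-- The upper image `cl (Γ(X) + C)`. -/
def upperImage (P : CVOP n q) : Set (L1Space q) :=
  closure (P.Γ '' P.X + (P.C : Set (L1Space q)))

/-- `x` is a weak minimizer: `x ∈ X` and `({Γ x} - int C) ∩ Γ(X) = ∅`. -/
def IsWeakMinimizer (P : CVOP n q) (x : EuclideanSpace ℝ (Fin n)) : Prop :=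
  x ∈ P.X ∧ ({P.Γ x} - interior (P.C : Set (L1Space q))) ∩ P.Γ '' P.X = ∅

/-- `Y` is a `δ`-outer approximation of the recession cone of the upper image. Both sets in the
Hausdorff distance are bounded and contain `0`. -/
def IsOuterApprox (P : CVOP n q) (δ : ℝ) (Y : Set (L1Space q)) : Prop :=
  recessionCone P.upperImage ⊆ cone Y ∧
    Metric.hausdorffDist (recessionCone P.upperImage ∩ Metric.closedBall 0 1)
      (cone Y ∩ Metric.closedBall 0 1) ≤ δ

/-- `(Xbar, Y)` is a finite weak `(ε, δ)`-solution (with respect to the fixed direction `c`). -/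
structure IsFiniteWeakSolution (P : CVOP n q) (c : L1Space q) (ε δ : ℝ)
    (Xbar : Set (EuclideanSpace ℝ (Fin n))) (Y : Set (L1Space q)) : Prop where
  finite_Xbar : Xbar.Finite
  finite_Y : Y.Finite
  nonempty : Xbar.Nonempty
  weakMinimizer : ∀ x ∈ Xbar, P.IsWeakMinimizer x
  outerApprox : P.IsOuterApprox δ Y
  subset : P.upperImage ⊆ convexHull ℝ (P.Γ '' Xbar) + cone Y - {ε • c}

/-! ### Scalarizations -/

/-- `P₁(w)`: minimize `wᵀ Γ x` subject to `x ∈ X`, is unbounded. -/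
def P1Unbounded (P : CVOP n q) (w : L1Space q) : Prop :=
  ¬ BddBelow ((fun x => dot w (P.Γ x)) '' P.X)

/-- `x` is an optimal solution of `P₁(w)`. -/
def P1Optimal (P : CVOP n q) (w : L1Space q) (x : EuclideanSpace ℝ (Fin n)) : Prop :=
  x ∈ P.X ∧ ∀ x' ∈ P.X, dot w (P.Γ x) ≤ dot w (P.Γ x')

/-- `(x, z)` is feasible for `P₂(v,d)`: maximize `z` subject to `x ∈ X`, `Γ x - v - z d ≤_C 0`. -/
def P2Feasible (P : CVOP n q) (v d : L1Space q) (x : EuclideanSpace ℝ (Fin n)) (z : ℝ) : Prop :=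
  x ∈ P.X ∧ v + z • d - P.Γ x ∈ P.C

/-- `P₂(v,d)` is unbounded. -/
def P2Unbounded (P : CVOP n q) (v d : L1Space q) : Prop :=
  ¬ BddAbove {z : ℝ | ∃ x, P.P2Feasible v d x z}

/-- `(x, z)` is an optimal solution of `P₂(v,d)`. -/
def P2Optimal (P : CVOP n q) (v d : L1Space q) (x : EuclideanSpace ℝ (Fin n)) (z : ℝ) : Prop :=
  P.P2Feasible v d x z ∧ ∀ x' z', P.P2Feasible v d x' z' → z' ≤ z

/-- `w` is feasible for the Lagrangian dual `D₂(v,d)`. -/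
def D2Feasible (P : CVOP n q) (d w : L1Space q) : Prop :=
  dot w d = -1 ∧ w ∈ dualCone (P.C : Set (L1Space q))

/-- The objective `sup_{x ∈ X} (-wᵀ Γ x) + wᵀ v` of `D₂(v,d)`, with values in `[-∞, ∞]`. -/
noncomputable def D2Objective (P : CVOP n q) (v w : L1Space q) : EReal :=
  (⨆ x ∈ P.X, ((-dot w (P.Γ x) : ℝ) : EReal)) + ((dot w v : ℝ) : EReal)

/-- `w` is an optimal solution of `D₂(v,d)`. -/
def D2Optimal (P : CVOP n q) (v d w : L1Space q) : Prop :=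
  P.D2Feasible d w ∧ ∀ w', P.D2Feasible d w' → P.D2Objective v w ≤ P.D2Objective v w'

/-! ### First algorithm: outer approximation of the recession cone -/

/-- The admissible inputs: `c ∈ int C` with `‖c‖ = 1`, a finite set `R` of generators of `C` with
`‖d‖ = 1` for `d ∈ R`, and a finite set `Rstar` of generators of `C⁺` with `cᵀ z = 1` for
`z ∈ Rstar`. -/
structure IsInput (P : CVOP n q) (c : L1Space q) (R Rstar : Finset (L1Space q)) : Prop where
  c_mem : c ∈ interior (P.C : Set (L1Space q))
  norm_c : ‖c‖ = 1
  cone_R : cone (R : Set (L1Space q)) = P.C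
  norm_R : ∀ d ∈ R, ‖d‖ = 1
  cone_Rstar : cone (Rstar : Set (L1Space q)) = dualCone (P.C : Set (L1Space q))
  dot_Rstar : ∀ z ∈ Rstar, dot c z = 1

/-- The variables of the first algorithm. -/
structure InitState (n q : ℕ) where
  YIn : Set (L1Space q)
  YOut : Set (L1Space q)
  Chat : Set (L1Space q)
  P0 : Set (L1Space q)
  Xbar : Set (EuclideanSpace ℝ (Fin n))
  b : Bool

/-- The initial values; `YOut` is not yet used. -/
def initialState (n : ℕ) {q : ℕ} (R : Finset (L1Space q)) : InitState n q where
  YIn := R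
  YOut := ∅
  Chat := ∅
  P0 := Set.univ
  Xbar := ∅
  b := true

/-- Check of boundedness, for one `z ∈ Rstar`. -/
inductive BoundednessStep (P : CVOP n q) (z : L1Space q) : InitState n q → InitState n q → Prop
  | unbounded (s : InitState n q) :
      P.P1Unbounded z → BoundednessStep P z s { s with b := false }
  | solved (s : InitState n q) (x : EuclideanSpace ℝ (Fin n)) :
      P.P1Optimal z x → BoundednessStep P z s
        { s with Xbar := s.Xbar ∪ {x}, P0 := s.P0 ∩ halfspace z (P.Γ x) }

/-- Check for lineality directions, for one `d ∈ -R`. -/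
inductive LinealityStep (P : CVOP n q) (v d : L1Space q) : InitState n q → InitState n q → Prop
  | unbounded (s : InitState n q) :
      P.P2Unbounded v d → LinealityStep P v d s { s with YIn := s.YIn ∪ {d} }
  | solved (s : InitState n q) (x : EuclideanSpace ℝ (Fin n)) (z : ℝ) (w : L1Space q) :
      P.P2Optimal v d x z → P.D2Optimal v d w → LinealityStep P v d s
        { s with Xbar := s.Xbar ∪ {x}, P0 := s.P0 ∩ halfspace w (P.Γ x) }

/-- One pass through the while loop: `d` is the chosen element of `YOut \ (YIn ∪ Chat)`, `r` a
nearest element of `YIn`, and `u = λ d + (1 - λ) r` the direction of the scalarization, for an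
arbitrary `λ ∈ (0,1)` with `u ≠ 0`. -/
inductive DirectionStep (P : CVOP n q) (δ : ℝ) (v : L1Space q) :
    InitState n q → InitState n q → Prop
  | close (s : InitState n q) (d r : L1Space q) :
      d ∈ s.YOut \ (s.YIn ∪ s.Chat) → r ∈ s.YIn → (∀ r' ∈ s.YIn, ‖d - r‖ ≤ ‖d - r'‖) →
      ‖d - r‖ ≤ δ →
      DirectionStep P δ v s { s with Chat := s.Chat ∪ {d} }
  | unbounded (s : InitState n q) (d r u : L1Space q) (lam : ℝ) :
      d ∈ s.YOut \ (s.YIn ∪ s.Chat) → r ∈ s.YIn → (∀ r' ∈ s.YIn, ‖d - r‖ ≤ ‖d - r'‖) →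
      δ < ‖d - r‖ → 0 < lam → lam < 1 → u = lam • d + (1 - lam) • r → u ≠ 0 →
      P.P2Unbounded v u →
      DirectionStep P δ v s { s with YIn := s.YIn ∪ {‖u‖⁻¹ • u} }
  | solved (s : InitState n q) (d r u : L1Space q) (lam : ℝ) (x : EuclideanSpace ℝ (Fin n)) (z : ℝ)
      (w : L1Space q) :
      d ∈ s.YOut \ (s.YIn ∪ s.Chat) → r ∈ s.YIn → (∀ r' ∈ s.YIn, ‖d - r‖ ≤ ‖d - r'‖) →
      δ < ‖d - r‖ → 0 < lam → lam < 1 → u = lam • d + (1 - lam) • r → u ≠ 0 →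
      P.P2Optimal v u x z → P.D2Optimal v u w →
      DirectionStep P δ v s
        { s with
          Xbar := s.Xbar ∪ {x}
          P0 := s.P0 ∩ halfspace w (P.Γ x)
          YOut := outerDirections (s.P0 ∩ halfspace w (P.Γ x)) }

/-- The first algorithm, applied to a feasible problem, can terminate in state `s`. -/
def InitTerminates (P : CVOP n q) (R Rstar : Finset (L1Space q)) (δ : ℝ)
    (s : InitState n q) : Prop :=
  ∃ x₀ ∈ P.X, ∃ v : L1Space q, v = P.Γ x₀ + ∑ d ∈ R, d ∧
  ∃ s₁ : InitState n q, ForEach P.BoundednessStep Rstar (initialState n R) s₁ ∧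
    ((s₁.b = true ∧ s = { s₁ with YOut := R }) ∨
     (s₁.b = false ∧
      ∃ s₂ : InitState n q,
        ForEach (P.LinealityStep v) (R.map (Equiv.neg (L1Space q)).toEmbedding) s₁ s₂ ∧
        Relation.ReflTransGen (P.DirectionStep δ v)
          { s₂ with YOut := outerDirections s₂.P0 } s ∧
        s.YOut \ (s.YIn ∪ s.Chat) = ∅))

/-! ### Second algorithm: the primal algorithm -/

/-- The variables of the primal algorithm; `Pk` is the current outer approximation. -/
structure MainState (n q : ℕ) where
  Pk : Set (L1Space q)
  M : Set (L1Space q)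
  Xbar : Set (EuclideanSpace ℝ (Fin n))

/-- The treatment of one vertex `v`, with `d = -c`. Here `P₂(v,-c)` asks for the largest `z` with
`Γ x ≤_C v - z c`, so `-z` is the shift along `c` needed to reach the upper image from `v`; it is
this number that is compared with `ε`. -/
inductive VertexStep (P : CVOP n q) (c : L1Space q) (ε : ℝ) (v : L1Space q) :
    MainState n q → MainState n q → Prop
  | far (s : MainState n q) (x : EuclideanSpace ℝ (Fin n)) (z : ℝ) (w : L1Space q) :
      P.P2Optimal v (-c) x z → P.D2Optimal v (-c) w → ε < -z →
      VertexStep P c ε v s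
        { s with Xbar := s.Xbar ∪ {x}, M := s.M ∩ halfspace w (P.Γ x) }
  | near (s : MainState n q) (x : EuclideanSpace ℝ (Fin n)) (z : ℝ) (w : L1Space q) :
      P.P2Optimal v (-c) x z → P.D2Optimal v (-c) w → -z ≤ ε →
      VertexStep P c ε v s { s with Xbar := s.Xbar ∪ {x} }

/-- One pass through the while loop "while `M ≠ ℝ^q`". -/
inductive MainStep (P : CVOP n q) (c : L1Space q) (ε : ℝ) : MainState n q → MainState n q → Prop
  | refine (s s' : MainState n q) (V : Finset (L1Space q)) :
      s.M ≠ Set.univ → IsVertexSet s.Pk V →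
      ForEach (P.VertexStep c ε) V { s with M := Set.univ } s' → s'.M ≠ Set.univ →
      MainStep P c ε s { s' with Pk := s'.Pk ∩ s'.M }
  | finish (s s' : MainState n q) (V : Finset (L1Space q)) :
      s.M ≠ Set.univ → IsVertexSet s.Pk V →
      ForEach (P.VertexStep c ε) V { s with M := Set.univ } s' → s'.M = Set.univ →
      MainStep P c ε s s'

/-- The primal algorithm can terminate with the output `(Xbar, YOut)`. -/
def PrimalTerminates (P : CVOP n q) (c : L1Space q) (R Rstar : Finset (L1Space q)) (ε δ : ℝ)
    (Xbar : Set (EuclideanSpace ℝ (Fin n))) (YOut : Set (L1Space q)) : Prop :=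
  ∃ s : InitState n q, P.InitTerminates R Rstar δ s ∧ YOut = s.YOut ∧
  ∃ t : MainState n q,
    Relation.ReflTransGen (P.MainStep c ε) ⟨s.P0, ∅, s.Xbar⟩ t ∧ t.M = Set.univ ∧ Xbar = t.Xbar

end CVOP

/-! ### Finite intersections of closed halfspaces -/

/-! Two containments drive everything: the upper image `𝒫` lies in every set the algorithm cuts, and
every element of `YIn` is a recession direction of `𝒫`. A cut is valid because its halfspace
supports `𝒫` at `Γ x`. For `P₁` this is optimality of `x`; for `P₂` it is strong duality under a
Slater condition (`upperImage_subset_of_optimal`). An unbounded `P₂(v,d)` makes `d` a limit of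
chords of the convex set `𝒫` (`mem_recessionCone_of_P2Unbounded`). Points collected are weak
minimizers, as strict domination would improve the scalarized optimum.

The polyhedron `P0` left by the first phase satisfies `cone YOut = (P0)_∞ ⊇ 𝒫_∞`, so only one side
of the Hausdorff distance matters. At loop exit each nonzero vertex of `(P0)_∞ ∩ B₁(0)` is `δ`-close
to `YIn`, and convexity spreads this to the whole set. If no `P₁(z)` was unbounded, the bipolar
theorem gives `(P0)_∞ = C = 𝒫_∞`.

A last round without a cut puts each vertex of `Pk`, shifted by `ε c`, into `Γ(X̄) + C`. Since `Pk =
conv V + (Pk)_∞` (`subset_convexHull_add_recessionCone`) and both `(Pk)_∞` and `C` lie in `cone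
YOut`, the final inclusion follows. -/

section HPolyhedron

variable {E : Type*} [AddCommGroup E] [Module ℝ E]

/-- The set of solutions of a finite system of linear inequalities `p.2 ≤ p.1 y`. -/
def solutionSet (S : Finset (Module.Dual ℝ E × ℝ)) : Set E := {y | ∀ p ∈ S, p.2 ≤ p.1 y}

/-- A finite intersection of closed halfspaces. -/
def IsHPolyhedron (A : Set E) : Prop :=
  ∃ S : Finset (Module.Dual ℝ E × ℝ), A = solutionSet S

theorem isHPolyhedron_univ : IsHPolyhedron (Set.univ : Set E) :=
  ⟨∅, by simp [solutionSet]⟩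

theorem IsHPolyhedron.inter {A B : Set E} (hA : IsHPolyhedron A) (hB : IsHPolyhedron B) :
    IsHPolyhedron (A ∩ B) := by
  classical
  obtain ⟨S, rfl⟩ := hA
  obtain ⟨T, rfl⟩ := hB
  refine ⟨S ∪ T, ?_⟩
  ext y
  simp only [solutionSet, Set.mem_inter_iff, Set.mem_ofPred_eq, Finset.mem_union]
  exact ⟨fun h p hp => hp.elim (h.1 p) (h.2 p),
    fun h => ⟨fun p hp => h p (Or.inl hp), fun p hp => h p (Or.inr hp)⟩⟩

theorem isHPolyhedron_setOf_le (f : Module.Dual ℝ E) (b : ℝ) : IsHPolyhedron {y | b ≤ f y} :=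
  ⟨{(f, b)}, by simp [solutionSet]⟩

/-- Finitely many strict inequalities survive one common small step, by continuity; only the active
ones can obstruct a move. -/
theorem exists_pos_add_smul_slack (S : Finset (Module.Dual ℝ E × ℝ)) (x d : E) :
    ∃ t : ℝ, 0 < t ∧ ∀ p ∈ S, p.2 < p.1 x → p.2 ≤ p.1 (x + t • d) := by
  have h : ∀ p ∈ S, ∀ᶠ t : ℝ in nhdsWithin 0 (Set.Ioi 0), p.2 < p.1 x → p.2 ≤ p.1 (x + t • d) := by
    intro p _
    by_cases hp : p.2 < p.1 x
    · have hc : Filter.Tendsto (fun t : ℝ => p.1 x + t * p.1 d) (nhds 0) (nhds (p.1 x)) := by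
        have : Continuous fun t : ℝ => p.1 x + t * p.1 d := by fun_prop
        simpa using this.tendsto 0
      filter_upwards [nhdsWithin_le_nhds (hc.eventually (lt_mem_nhds hp))] with t ht _
      simpa using ht.le
    · exact Filter.Eventually.of_forall fun t h => absurd h hp
  obtain ⟨t, h1, h2⟩ := (((Finset.eventually_all S).2 h).and self_mem_nhdsWithin).exists
  exact ⟨t, h2, h1⟩

/-- A polyhedron has only finitely many extreme points: an extreme point is determined by the
inequalities that are active at it. -/
theorem finite_extremePoints_solutionSet (S : Finset (Module.Dual ℝ E × ℝ)) :
    ((solutionSet S).extremePoints ℝ).Finite := by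
  classical
  refine Set.Finite.of_injOn (f := fun x => S.filter fun p => p.1 x = p.2)
    (t := (S.powerset : Set (Finset (Module.Dual ℝ E × ℝ)))) ?_ ?_ (Finset.finite_toSet _)
  · intro x _
    exact Finset.mem_coe.2 (Finset.mem_powerset.2 (Finset.filter_subset _ _))
  · intro x hx y hy hxy
    -- With equal active sets, active functionals are constant along `x - y`, so `x` lies strictly
    -- between `y` and a feasible point beyond `x`.
    obtain ⟨t, ht, h⟩ := exists_pos_add_smul_slack S x (x - y)
    have hxA : x ∈ solutionSet S := hx.1
    have hmem : x + t • (x - y) ∈ solutionSet S := by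
      intro p hp
      rcases (hxA p hp).lt_or_eq with hlt | heq
      · exact h p hp hlt
      · have h1 : p ∈ S.filter fun p => p.1 x = p.2 := by simp [hp, heq]
        have h2 : p ∈ S.filter fun p => p.1 y = p.2 := by
          have hxy' : (S.filter fun p => p.1 x = p.2) = S.filter fun p => p.1 y = p.2 := hxy
          exact hxy' ▸ h1
        have h3 := (Finset.mem_filter.1 h2).2
        simp [h3, ← heq]
    refine ((mem_extremePoints.1 hx).2 y hy.1 _ hmem ?_).1.symm
    refine ⟨t / (1 + t), 1 / (1 + t), by positivity, by positivity, by field_simp; ring, ?_⟩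
    have h1 : (1 + t) ≠ 0 := by positivity
    match_scalars <;> field_simp
    ring

theorem IsHPolyhedron.finite_extremePoints {A : Set E} (hA : IsHPolyhedron A) :
    (A.extremePoints ℝ).Finite := by
  obtain ⟨S, rfl⟩ := hA
  exact finite_extremePoints_solutionSet S

/-- The ratio test: the smallest quotient of slack by rate of decrease is the first moment at which
a decreasing inequality becomes active. -/
theorem exists_smul_add_active {S : Finset (Module.Dual ℝ E × ℝ)} {x d : E}
    (hx : x ∈ solutionSet S) (hd : ∃ p ∈ S, p.1 d < 0) :
    ∃ t : ℝ, 0 ≤ t ∧ x + t • d ∈ solutionSet S ∧ ∃ p ∈ S, p.1 d < 0 ∧ p.1 (x + t • d) = p.2 := by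
  classical
  obtain ⟨p, hp, hmin⟩ := Finset.exists_min_image (S.filter fun p => p.1 d < 0)
    (fun p => (p.1 x - p.2) / (-p.1 d)) (by
      obtain ⟨p, hp, hpd⟩ := hd
      exact ⟨p, by simp [hp, hpd]⟩)
  obtain ⟨hpS, hpd⟩ := Finset.mem_filter.1 hp
  have ht : 0 ≤ (p.1 x - p.2) / (-p.1 d) :=
    div_nonneg (sub_nonneg.2 (hx p hpS)) (by linarith)
  refine ⟨_, ht, ?_, p, hpS, hpd, ?_⟩
  · intro p' hp'
    simp only [map_add, map_smul, smul_eq_mul]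
    rcases lt_or_ge (p'.1 d) 0 with hneg | hpos
    · have h1 := hmin p' (by simp [hp', hneg])
      rw [le_div_iff₀ (by linarith)] at h1
      linarith
    · have := hx p' hp'
      have := mul_nonneg ht hpos
      linarith
  · have : p.1 d ≠ 0 := hpd.ne
    simp only [map_add, map_smul, smul_eq_mul]
    field_simp
    ring

/-- A polyhedron without lines is the sum of the convex hull of its extreme points and its
recession cone. -/
theorem mem_convexHull_extremePoints_add {S : Finset (Module.Dual ℝ E × ℝ)}
    (hline : ∀ d : E, (∀ p ∈ S, p.1 d = 0) → d = 0) (x : E) (hx : x ∈ solutionSet S) :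
    x ∈ convexHull ℝ ((solutionSet S).extremePoints ℝ) + {d | ∀ p ∈ S, 0 ≤ p.1 d} := by
  classical
  -- Induction on the number of inactive inequalities: a non-extreme `x` is moved both ways along a
  -- segment through it until a new inequality becomes active.
  induction hn : (S.filter fun p => p.2 < p.1 x).card using Nat.strong_induction_on
    generalizing x with
  | _ m ih =>
  subst hn
  have hconv : Convex ℝ (convexHull ℝ ((solutionSet S).extremePoints ℝ) +
      {d | ∀ p ∈ S, 0 ≤ p.1 d}) := by
    refine (convex_convexHull ℝ _).add ?_
    intro a ha b hb s t hs ht _ p hp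
    simp only [map_add, map_smul, smul_eq_mul]
    exact add_nonneg (mul_nonneg hs (ha p hp)) (mul_nonneg ht (hb p hp))
  by_cases hext : x ∈ (solutionSet S).extremePoints ℝ
  · exact ⟨x, subset_convexHull ℝ _ hext, 0, by simp, by simp⟩
  rw [mem_extremePoints] at hext
  push Not at hext
  obtain ⟨x₁, hx₁, x₂, hx₂, ⟨a, b, ha, hb, hab, hxe⟩, hne⟩ := hext hx
  -- A functional minimal at an interior point of a segment is constant on it.
  have hact : ∀ p ∈ S, p.1 x = p.2 → p.1 (x₂ - x₁) = 0 := by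
    intro p hp hpx
    have e : a * p.1 x₁ + b * p.1 x₂ = p.2 := by rw [← hpx, ← hxe]; simp
    have l1 := hx₁ p hp
    have l2 := hx₂ p hp
    have e1 : a * (p.1 x₁ - p.2) + b * (p.1 x₂ - p.2) = 0 := by
      linear_combination e - p.2 * hab
    have n1 := mul_nonneg ha.le (sub_nonneg.2 l1)
    have n2 := mul_nonneg hb.le (sub_nonneg.2 l2)
    have z1 : a * (p.1 x₁ - p.2) = 0 := by linarith
    have z2 : b * (p.1 x₂ - p.2) = 0 := by linarith
    have w1 := (mul_eq_zero.1 z1).resolve_left ha.ne'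
    have w2 := (mul_eq_zero.1 z2).resolve_left hb.ne'
    rw [map_sub]
    linarith
  have hd0 : x₂ - x₁ ≠ 0 := by
    intro h0
    have h12 : x₂ = x₁ := sub_eq_zero.1 h0
    have : x₁ = x := by rw [← hxe, h12, ← add_smul, hab, one_smul]
    exact hne this (h12.trans this)
  have key : ∀ d : E, (∀ p ∈ S, p.1 x = p.2 → p.1 d = 0) → (∃ p ∈ S, p.1 d < 0) →
      ∃ t : ℝ, 0 ≤ t ∧ x + t • d ∈
        convexHull ℝ ((solutionSet S).extremePoints ℝ) + {d | ∀ p ∈ S, 0 ≤ p.1 d} := by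
    intro d hd hneg
    obtain ⟨t, ht, hmem, p, hp, hpd, hpe⟩ := exists_smul_add_active hx hneg
    refine ⟨t, ht, ih _ (Finset.card_lt_card ?_) _ hmem rfl⟩
    rw [Finset.ssubset_iff_of_subset]
    · refine ⟨p, ?_, fun h => (Finset.mem_filter.1 h).2.ne' hpe⟩
      rw [Finset.mem_filter]
      refine ⟨hp, lt_of_le_of_ne (hx p hp) fun h => ?_⟩
      exact hpd.ne (hd p hp h.symm)
    · intro r hr
      obtain ⟨hrS, hrl⟩ := Finset.mem_filter.1 hr
      rw [Finset.mem_filter]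
      refine ⟨hrS, lt_of_le_of_ne (hx r hrS) fun h => ?_⟩
      rw [map_add, map_smul, hd r hrS h.symm, ← h] at hrl
      simp at hrl
  have rec_add : ∀ y ∈ convexHull ℝ ((solutionSet S).extremePoints ℝ) +
      {d | ∀ p ∈ S, 0 ≤ p.1 d}, ∀ e : E, (∀ p ∈ S, 0 ≤ p.1 e) →
      y + e ∈ convexHull ℝ ((solutionSet S).extremePoints ℝ) + {d | ∀ p ∈ S, 0 ≤ p.1 d} := by
    rintro _ ⟨u, hu, k, hk, rfl⟩ e he
    refine ⟨u, hu, k + e, fun p hp => ?_, by simp only [add_assoc]⟩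
    rw [map_add]
    exact add_nonneg (hk p hp) (he p hp)
  have hact' : ∀ p ∈ S, p.1 x = p.2 → p.1 (-(x₂ - x₁)) = 0 := fun p hp h => by
    rw [map_neg, hact p hp h, neg_zero]
  by_cases h1 : ∃ p ∈ S, p.1 (x₂ - x₁) < 0
  · obtain ⟨t, ht, hy⟩ := key _ hact h1
    by_cases h2 : ∃ p ∈ S, p.1 (-(x₂ - x₁)) < 0
    · obtain ⟨s, hs, hz⟩ := key _ hact' h2
      rcases (add_nonneg ht hs).eq_or_lt with h0 | hpos
      · have : t = 0 := by linarith
        simpa [this] using hy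
      -- The point `x` is the mean of `x + t d` and `x - s d` with weights `s/(t+s)` and `t/(t+s)`.
      · have := hconv hy hz (div_nonneg hs hpos.le) (div_nonneg ht hpos.le)
          (by field_simp; ring)
        convert this using 1
        apply smul_right_injective E hpos.ne'
        simp only [smul_add, smul_smul]
        rw [mul_div_assoc', mul_div_cancel_left₀ _ hpos.ne', mul_div_assoc',
          mul_div_cancel_left₀ _ hpos.ne']
        module
    · push Not at h2
      have := rec_add _ hy (t • (-(x₂ - x₁))) fun p hp => by
        rw [map_smul]; exact mul_nonneg ht (h2 p hp)
      rwa [add_assoc, smul_neg, add_neg_cancel, add_zero] at this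
  · push Not at h1
    by_cases h2 : ∃ p ∈ S, p.1 (-(x₂ - x₁)) < 0
    · obtain ⟨s, hs, hz⟩ := key _ hact' h2
      have := rec_add _ hz (s • (x₂ - x₁)) fun p hp => by
        rw [map_smul]; exact mul_nonneg hs (h1 p hp)
      rwa [add_assoc, smul_neg, neg_add_cancel, add_zero] at this
    · push Not at h2
      -- No functional decreases either way, so the direction spans a line, which is excluded.
      refine absurd (hline _ fun p hp => le_antisymm ?_ (h1 p hp)) hd0
      have := h2 p hp
      rw [map_neg] at this
      linarith

end HPolyhedron

namespace L1Space

variable {q : ℕ}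

/-! ### The scalar product -/

theorem dot_add (w x y : L1Space q) : dot w (x + y) = dot w x + dot w y := by
  simp [dot, mul_add, Finset.sum_add_distrib]

theorem dot_smul (w : L1Space q) (a : ℝ) (y : L1Space q) : dot w (a • y) = a * dot w y := by
  simp [dot, Finset.mul_sum, mul_left_comm]

theorem dot_comm (w y : L1Space q) : dot w y = dot y w := by
  simp [dot, mul_comm]

theorem smul_dot (w : L1Space q) (a : ℝ) (y : L1Space q) : dot (a • w) y = a * dot w y := by
  rw [dot_comm, dot_smul, dot_comm]

theorem dot_neg (w y : L1Space q) : dot w (-y) = -dot w y := by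
  simp [dot]

theorem dot_sub (w x y : L1Space q) : dot w (x - y) = dot w x - dot w y := by
  rw [sub_eq_add_neg, dot_add, dot_neg, sub_eq_add_neg]

/-- `y ↦ wᵀ y` as a linear functional. -/
noncomputable def dotHom (w : L1Space q) : Module.Dual ℝ (L1Space q) where
  toFun := dot w
  map_add' := dot_add w
  map_smul' := dot_smul w

@[simp] theorem dotHom_apply (w y : L1Space q) : dotHom w y = dot w y := rfl

theorem dot_sum {ι : Type*} (w : L1Space q) (s : Finset ι) (f : ι → L1Space q) :
    dot w (∑ i ∈ s, f i) = ∑ i ∈ s, dot w (f i) :=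
  map_sum (dotHom w) f s

theorem dot_self_pos {w : L1Space q} (hw : w ≠ 0) : 0 < dot w w := by
  have h0 : 0 ≤ dot w w := Finset.sum_nonneg fun i _ => mul_self_nonneg (w i)
  refine lt_of_le_of_ne h0 fun h => hw ?_
  have := (Finset.sum_eq_zero_iff_of_nonneg fun i _ => mul_self_nonneg (w i)).1 h.symm
  ext i
  simpa using this i (Finset.mem_univ i)

theorem exists_eq_dot (f : L1Space q →ₗ[ℝ] ℝ) : ∃ w : L1Space q, ∀ y, f y = dot w y := by
  refine ⟨WithLp.toLp 1 fun i => f (PiLp.basisFun 1 ℝ (Fin q) i), fun y => ?_⟩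
  conv_lhs => rw [← (PiLp.basisFun 1 ℝ (Fin q)).sum_repr y]
  simp [dot, mul_comm]

theorem isHPolyhedron_halfspace (w p : L1Space q) : IsHPolyhedron (halfspace w p) := by
  convert isHPolyhedron_setOf_le (dotHom w) (dot w p) using 1
  ext y
  simp [halfspace, dot_sub]

/-- The `ℓ₁` ball is cut out by one inequality per sign vector; the binding one has signs opposite
to those of `y`. -/
theorem isHPolyhedron_closedBall :
    IsHPolyhedron (Metric.closedBall (0 : L1Space q) 1) := by
  classical
  let s : Finset (Fin q) → L1Space q := fun I => WithLp.toLp 1 fun i => if i ∈ I then 1 else -1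
  refine ⟨Finset.univ.image fun I => (dotHom (s I), -1), ?_⟩
  ext y
  simp only [mem_closedBall_zero_iff, PiLp.norm_eq_of_L1, solutionSet, Finset.mem_image,
    Finset.mem_univ, true_and, Set.mem_ofPred_eq, forall_exists_index, forall_apply_eq_imp_iff,
    dotHom_apply]
  constructor
  · intro h I
    have : ∑ i, -‖y i‖ ≤ dot (s I) y := by
      refine Finset.sum_le_sum fun i _ => ?_
      simp only [s, Real.norm_eq_abs]
      split_ifs
      · simpa using neg_abs_le (y i)
      · simpa using le_abs_self (y i)
    rw [Finset.sum_neg_distrib] at this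
    linarith
  · intro h
    have h1 := h (Finset.univ.filter fun i => y i < 0)
    have : dot (s (Finset.univ.filter fun i => y i < 0)) y = ∑ i, -‖y i‖ := by
      refine Finset.sum_congr rfl fun i _ => ?_
      simp only [s, Finset.mem_filter, Finset.mem_univ, true_and, Real.norm_eq_abs]
      split_ifs with hi
      · rw [abs_of_neg hi]; ring
      · rw [abs_of_nonneg (not_lt.1 hi)]; ring
    rw [this, Finset.sum_neg_distrib] at h1
    linarith

/-! ### Cones and recession cones -/

theorem subset_cone (A : Set (L1Space q)) : A ⊆ cone A := PointedCone.subset_hull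

theorem zero_mem_cone (A : Set (L1Space q)) : (0 : L1Space q) ∈ cone A :=
  (PointedCone.hull ℝ A).zero_mem

theorem add_mem_cone {A : Set (L1Space q)} {x y : L1Space q} (hx : x ∈ cone A) (hy : y ∈ cone A) :
    x + y ∈ cone A :=
  (PointedCone.hull ℝ A).add_mem hx hy

theorem smul_mem_cone {A : Set (L1Space q)} {a : ℝ} (ha : 0 ≤ a) {x : L1Space q}
    (hx : x ∈ cone A) : a • x ∈ cone A :=
  (PointedCone.hull ℝ A).smul_mem ha hx

theorem convex_cone (A : Set (L1Space q)) : Convex ℝ (cone A) :=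
  fun _ hx _ hy _ _ ha hb _ => add_mem_cone (smul_mem_cone ha hx) (smul_mem_cone hb hy)

theorem cone_subset {A B : Set (L1Space q)} (hAB : A ⊆ B) (h0 : (0 : L1Space q) ∈ B)
    (hadd : ∀ x ∈ B, ∀ y ∈ B, x + y ∈ B) (hsmul : ∀ a : ℝ, 0 ≤ a → ∀ x ∈ B, a • x ∈ B) :
    cone A ⊆ B := by
  intro x hx
  refine Submodule.span_induction (R := {r : ℝ // 0 ≤ r}) (p := fun x _ => x ∈ B) (fun x hx => hAB hx) h0
    (fun x y _ _ hx hy => hadd x hx y hy) (fun a x _ hx => hsmul a a.2 x hx) hx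

theorem zero_mem_recessionCone (A : Set (L1Space q)) : (0 : L1Space q) ∈ recessionCone A :=
  fun y hy a _ => by simpa using hy

theorem add_mem_recessionCone {A : Set (L1Space q)} {d e : L1Space q} (hd : d ∈ recessionCone A)
    (he : e ∈ recessionCone A) : d + e ∈ recessionCone A := by
  intro y hy a ha
  rw [smul_add, ← add_assoc]
  exact he _ (hd y hy a ha) a ha

theorem smul_mem_recessionCone {A : Set (L1Space q)} {a : ℝ} (ha : 0 ≤ a) {d : L1Space q}
    (hd : d ∈ recessionCone A) : a • d ∈ recessionCone A := by
  intro y hy b hb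
  rw [smul_smul]
  exact hd y hy _ (mul_nonneg hb ha)

theorem convex_recessionCone (A : Set (L1Space q)) : Convex ℝ (recessionCone A) :=
  fun _ hx _ hy _ _ ha hb _ =>
    add_mem_recessionCone (smul_mem_recessionCone ha hx) (smul_mem_recessionCone hb hy)

theorem cone_subset_recessionCone {A B : Set (L1Space q)} (h : A ⊆ recessionCone B) :
    cone A ⊆ recessionCone B :=
  cone_subset h (zero_mem_recessionCone B) (fun _ hx _ hy => add_mem_recessionCone hx hy)
    fun _ ha _ hx => smul_mem_recessionCone ha hx

theorem nonneg_of_mem_recessionCone {A : Set (L1Space q)} (hA : A.Nonempty) {f : L1Space q → ℝ}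
    (hf : ∀ (y : L1Space q) (a : ℝ) (d : L1Space q), f (y + a • d) = f y + a * f d) {b : ℝ}
    (hAf : ∀ y ∈ A, b ≤ f y) {d : L1Space q} (hd : d ∈ recessionCone A) : 0 ≤ f d := by
  obtain ⟨y, hy⟩ := hA
  by_contra! hneg
  have hne : f d ≠ 0 := hneg.ne
  -- This step length brings the value of `f` down to `b - 1`.
  have h := hAf _ (hd y hy ((f y - b + 1) / (-f d))
    (div_nonneg (by linarith [hAf y hy]) (by linarith)))
  rw [hf] at h
  have : (f y - b + 1) / (-f d) * f d = -(f y - b + 1) := by field_simp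
  linarith

theorem recessionCone_solutionSet {S : Finset (Module.Dual ℝ (L1Space q) × ℝ)}
    (hS : (solutionSet S).Nonempty) :
    recessionCone (solutionSet S) = {d | ∀ p ∈ S, 0 ≤ p.1 d} := by
  ext d
  constructor
  · intro hd p hp
    exact nonneg_of_mem_recessionCone hS (f := p.1) (by simp) (fun y hy => hy p hp) hd
  · intro hd y hy a ha p hp
    rw [map_add, map_smul]
    exact le_add_of_le_of_nonneg (hy p hp) (mul_nonneg ha (hd p hp))

/-- Recession cones of arbitrary sets are not monotone. Here the functionals defining `B` are
bounded below on `A`, hence nonnegative on its recession directions. -/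
theorem recessionCone_mono {A B : Set (L1Space q)} (hA : A.Nonempty) (hAB : A ⊆ B)
    (hB : IsHPolyhedron B) : recessionCone A ⊆ recessionCone B := by
  obtain ⟨S, rfl⟩ := hB
  rw [recessionCone_solutionSet (hA.mono hAB)]
  intro d hd p hp
  exact nonneg_of_mem_recessionCone hA (f := p.1) (by simp) (fun y hy => hAB hy p hp) hd

theorem isHPolyhedron_recessionCone {A : Set (L1Space q)} (hA : A.Nonempty)
    (h : IsHPolyhedron A) : IsHPolyhedron (recessionCone A) := by
  classical
  obtain ⟨S, rfl⟩ := h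
  refine ⟨S.image fun p => (p.1, 0), ?_⟩
  rw [recessionCone_solutionSet hA]
  ext d
  simp only [solutionSet, Set.mem_ofPred_eq, Finset.mem_image]
  exact ⟨by rintro h _ ⟨p, hp, rfl⟩; exact h p hp, fun h p hp => h _ ⟨p, hp, rfl⟩⟩

theorem isClosed_of_isHPolyhedron {A : Set (L1Space q)} (h : IsHPolyhedron A) : IsClosed A := by
  obtain ⟨S, rfl⟩ := h
  simp only [solutionSet, Set.ofPred_forall]
  exact isClosed_biInter fun p _ =>
    isClosed_le continuous_const (LinearMap.continuous_of_finiteDimensional p.1)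

/-- Every vertex set of a polyhedron, together with the recession cone, generates it. -/
theorem subset_convexHull_add_recessionCone {A : Set (L1Space q)} (hA : IsHPolyhedron A)
    {V : Finset (L1Space q)} (hV : IsVertexSet A V) :
    A ⊆ convexHull ℝ (V : Set (L1Space q)) + recessionCone A := by
  rcases hV with ⟨⟨v, hv⟩, hVe⟩ | ⟨_, K, _, hK⟩
  · obtain ⟨S, rfl⟩ := hA
    have hvx : v ∈ (solutionSet S).extremePoints ℝ := hVe ▸ hv
    intro x hx
    rw [recessionCone_solutionSet ⟨x, hx⟩, hVe]
    refine mem_convexHull_extremePoints_add (fun d hd => ?_) x hx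
    -- An extreme point forbids lines: it would be the midpoint of `v - d` and `v + d`.
    have h := (mem_extremePoints.1 hvx).2 (v - d) (fun p hp => ?_) (v + d) (fun p hp => ?_)
      ⟨1 / 2, 1 / 2, by norm_num, by norm_num, by norm_num, by module⟩
    · simpa using h.2
    · simpa [hd p hp] using hvx.1 p hp
    · simpa [hd p hp] using hvx.1 p hp
  · conv_lhs => rw [hK]
    refine Set.add_subset_add_left (cone_subset_recessionCone fun k hk => ?_)
    rw [hK]
    rintro _ ⟨u, hu, e, he, rfl⟩ a ha
    refine ⟨u, hu, e + a • k, add_mem_cone he (smul_mem_cone ha (subset_cone _ hk)), ?_⟩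
    simp only [add_assoc]

/-! ### Vertices of the truncated recession cone -/

section OuterDirections

variable {A : Set (L1Space q)}

theorem finite_extremePoints_recessionCone_inter (hA : A.Nonempty) (h : IsHPolyhedron A) :
    ((recessionCone A ∩ Metric.closedBall 0 1).extremePoints ℝ).Finite :=
  ((isHPolyhedron_recessionCone hA h).inter isHPolyhedron_closedBall).finite_extremePoints

/-- Krein–Milman; finiteness of the extreme points makes the closure superfluous. -/
theorem recessionCone_inter_eq_convexHull (hA : A.Nonempty) (h : IsHPolyhedron A) :
    recessionCone A ∩ Metric.closedBall 0 1 =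
      convexHull ℝ ((recessionCone A ∩ Metric.closedBall 0 1).extremePoints ℝ) := by
  have hc : IsCompact (recessionCone A ∩ Metric.closedBall (0 : L1Space q) 1) :=
    (isCompact_closedBall _ _).inter_left
      (isClosed_of_isHPolyhedron (isHPolyhedron_recessionCone hA h))
  have := closure_convexHull_extremePoints hc
    ((convex_recessionCone A).inter (convex_closedBall _ _))
  rw [((finite_extremePoints_recessionCone_inter hA h).isClosed_convexHull ℝ).closure_eq] at this
  exact this.symm

theorem cone_outerDirections (hA : A.Nonempty) (h : IsHPolyhedron A) :
    cone (outerDirections A) = recessionCone A := by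
  refine Set.Subset.antisymm (cone_subset_recessionCone fun d hd => hd.1.1.1) fun d hd => ?_
  rcases eq_or_ne d 0 with rfl | hne
  · exact zero_mem_cone _
  have hmem : ‖d‖⁻¹ • d ∈ recessionCone A ∩ Metric.closedBall 0 1 := by
    refine ⟨smul_mem_recessionCone (by positivity) hd, ?_⟩
    rw [mem_closedBall_zero_iff, norm_smul, norm_inv, norm_norm,
      inv_mul_cancel₀ (norm_ne_zero_iff.2 hne)]
  rw [recessionCone_inter_eq_convexHull hA h] at hmem
  have hsub : convexHull ℝ ((recessionCone A ∩ Metric.closedBall 0 1).extremePoints ℝ) ⊆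
      cone (outerDirections A) := by
    refine convexHull_min (fun y hy => ?_) (convex_cone _)
    by_cases hy0 : y = 0
    · rw [hy0]
      exact zero_mem_cone _
    · exact subset_cone _ ⟨hy, hy0⟩
  have := smul_mem_cone (norm_nonneg d) (hsub hmem)
  rwa [smul_smul, mul_inv_cancel₀ (norm_ne_zero_iff.2 hne), one_smul] at this

/-- If every outer direction of `A` is within `δ` of a convex subset `B` of the unit ball with
`0 ∈ B`, so is every recession direction in the unit ball. -/
theorem exists_dist_le_of_outerDirections (hA : A.Nonempty) (h : IsHPolyhedron A) {δ : ℝ}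
    (hδ : 0 ≤ δ) {B : Set (L1Space q)} (hB : Convex ℝ B) (h0 : (0 : L1Space q) ∈ B)
    (hd : ∀ d ∈ outerDirections A, ∃ r ∈ B, ‖d - r‖ ≤ δ) {y : L1Space q}
    (hy : y ∈ recessionCone A ∩ Metric.closedBall 0 1) : ∃ r ∈ B, dist y r ≤ δ := by
  rw [recessionCone_inter_eq_convexHull hA h] at hy
  -- The `δ`-neighbourhood of `B` is convex, so extreme points suffice; the origin, dropped from the
  -- outer directions, is covered by `0 ∈ B`.
  have hsub : convexHull ℝ ((recessionCone A ∩ Metric.closedBall 0 1).extremePoints ℝ) ⊆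
      B + Metric.closedBall (0 : L1Space q) δ := by
    refine convexHull_min (fun y hy => ?_) (hB.add (convex_closedBall _ _))
    by_cases hy0 : y = 0
    · exact ⟨0, h0, 0, by simpa using hδ, by simp [hy0]⟩
    · obtain ⟨r, hr, hyr⟩ := hd y ⟨hy, hy0⟩
      exact ⟨r, hr, y - r, by simpa using hyr, by simp⟩
  obtain ⟨r, hr, e, he, rfl⟩ := hsub hy
  exact ⟨r, hr, by simpa [dist_eq_norm] using he⟩

end OuterDirections

/-- The bipolar theorem: a functional separating `y` from the cone must be nonnegative on the cone,
else scaling brings its value down to the separating constant. -/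
theorem mem_of_forall_dualCone {C : ConvexCone ℝ (L1Space q)}
    (hC : IsClosed (C : Set (L1Space q))) (h0 : (0 : L1Space q) ∈ C) {y : L1Space q}
    (hy : ∀ z ∈ dualCone (C : Set (L1Space q)), 0 ≤ dot z y) : y ∈ C := by
  by_contra hn
  obtain ⟨f, u, hf, hu⟩ := geometric_hahn_banach_point_closed C.convex hC hn
  obtain ⟨w, hw⟩ := exists_eq_dot (f : L1Space q →ₗ[ℝ] ℝ)
  have hw' : ∀ x, f x = dot w x := hw
  have hu0 : u < 0 := by simpa using hu 0 h0
  have hneg : dot w y < 0 := by rw [← hw']; linarith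
  refine hneg.not_ge (hy w fun x hx => ?_)
  by_contra! hx0
  have h2 := hu _ (C.smul_mem (div_pos_of_neg_of_neg hu0 hx0) hx)
  have hne : dot w x ≠ 0 := hx0.ne
  rw [hw', dot_smul, div_mul_cancel₀ _ hne] at h2
  exact lt_irrefl _ h2

end L1Space

/-- A property that is preserved by every step of a loop is preserved by the loop. -/
theorem ForEach.invariant {α σ : Type} {step : α → σ → σ → Prop} {I : σ → Prop} {S : Finset α}
    {s s' : σ} (h : ForEach step S s s')
    (hstep : ∀ a ∈ S, ∀ t t', step a t t' → I t → I t') (hs : I s) : I s' := by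
  induction h with
  | done s => exact hs
  | next a S ha s₁ s₂ s₃ h12 _ ih =>
    exact ih (fun b hb => hstep b (Finset.mem_cons_of_mem hb))
      (hstep a (Finset.mem_cons_self a S) _ _ h12 hs)

namespace CVOP

variable {n q : ℕ} {P : CVOP n q}

/-! ### The upper image and duality for the scalarizations -/

namespace Regular

theorem zero_mem_C (hP : P.Regular) : (0 : L1Space q) ∈ P.C :=
  hP.zero_ssubset_C.1 rfl

theorem smul_mem_C (hP : P.Regular) {a : ℝ} (ha : 0 ≤ a) {k : L1Space q} (hk : k ∈ P.C) :
    a • k ∈ P.C := by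
  rcases ha.eq_or_lt with rfl | h
  · rw [zero_smul]
    exact hP.zero_mem_C
  · exact P.C.smul_mem h hk

theorem add_mem_interior_C {k l : L1Space q} (hk : k ∈ P.C)
    (hl : l ∈ interior (P.C : Set (L1Space q))) : k + l ∈ interior (P.C : Set (L1Space q)) := by
  have hopen : IsOpen ((fun y => k + y) '' interior (P.C : Set (L1Space q))) :=
    (Homeomorph.addLeft k).isOpenMap _ isOpen_interior
  refine interior_maximal ?_ hopen ⟨l, hl, rfl⟩
  rintro _ ⟨y, hy, rfl⟩
  exact P.C.add_mem hk (interior_subset hy)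

theorem exists_pos_add_smul_mem {k : L1Space q} (hk : k ∈ interior (P.C : Set (L1Space q)))
    (d : L1Space q) : ∃ t : ℝ, 0 < t ∧ k + t • d ∈ P.C := by
  have hc : Filter.Tendsto (fun t : ℝ => k + t • d) (nhds 0) (nhds k) := by
    have : Continuous fun t : ℝ => k + t • d := by fun_prop
    simpa using this.tendsto 0
  have hev : ∀ᶠ t : ℝ in nhdsWithin 0 (Set.Ioi 0), k + t • d ∈ P.C :=
    nhdsWithin_le_nhds (hc.eventually (mem_interior_iff_mem_nhds.1 hk))
  obtain ⟨t, h1, h2⟩ := (hev.and self_mem_nhdsWithin).exists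
  exact ⟨t, h2, h1⟩

/-- For small `t > 0` the point `k - t w` is still in `C`, whence `wᵀk ≥ t wᵀw > 0`. -/
theorem dot_pos {w k : L1Space q} (hw : w ∈ dualCone (P.C : Set (L1Space q))) (hw0 : w ≠ 0)
    (hk : k ∈ interior (P.C : Set (L1Space q))) : 0 < dot w k := by
  obtain ⟨t, ht, h⟩ := exists_pos_add_smul_mem hk (-w)
  have := hw _ h
  rw [dot_add, dot_smul, dot_neg] at this
  have := mul_pos ht (dot_self_pos hw0)
  linarith

/-- The defect in `C`-convexity is absorbed by `D`; both `D = C` and `D = int C` are needed. -/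
theorem convex_image_add (hP : P.Regular) {D : Set (L1Space q)} (hD : Convex ℝ D)
    (hCD : ∀ k ∈ P.C, ∀ l ∈ D, k + l ∈ D) : Convex ℝ (P.Γ '' P.X + D) := by
  rintro _ ⟨_, ⟨x, hx, rfl⟩, k, hk, rfl⟩ _ ⟨_, ⟨y, hy, rfl⟩, l, hl, rfl⟩ a b ha hb hab
  obtain rfl : b = 1 - a := by linarith
  refine ⟨_, ⟨_, hP.convex_X hx hy ha hb hab, rfl⟩, _,
    hCD _ (hP.convex_Γ x hx y hy a ha (by linarith)) _ (hD hk hl ha hb hab), ?_⟩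
  simp only
  module

theorem convex_upperImage (hP : P.Regular) : Convex ℝ P.upperImage :=
  (hP.convex_image_add P.C.convex fun _ hk _ hl => P.C.add_mem hk hl).closure

theorem image_subset_upperImage (hP : P.Regular) : P.Γ '' P.X ⊆ P.upperImage := fun y hy =>
  subset_closure ⟨y, hy, 0, hP.zero_mem_C, by simp⟩

theorem upperImage_nonempty (hP : P.Regular) : P.upperImage.Nonempty :=
  (((hP.interior_X.mono interior_subset).image P.Γ)).mono hP.image_subset_upperImage

theorem C_subset_recessionCone (hP : P.Regular) :
    (P.C : Set (L1Space q)) ⊆ recessionCone P.upperImage := by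
  intro k hk y hy a ha
  refine map_mem_closure (f := fun y => y + a • k) (by fun_prop) hy ?_
  rintro _ ⟨g, hg, l, hl, rfl⟩
  exact ⟨g, hg, l + a • k, P.C.add_mem hl (hP.smul_mem_C ha hk), by simp only [add_assoc]⟩

/-- A direction along which feasible points go to infinity is a recession direction. -/
theorem mem_recessionCone_of_P2Unbounded (hP : P.Regular) {v d : L1Space q}
    (h : P.P2Unbounded v d) : d ∈ recessionCone P.upperImage := by
  intro y hy a ha
  rw [P2Unbounded, not_bddAbove_iff] at h
  choose z hz hlt using fun m : ℕ => h (m + a)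
  have hzm : ∀ m, v + z m • d ∈ P.upperImage := by
    intro m
    obtain ⟨x, hx, hk⟩ := hz m
    exact subset_closure ⟨_, ⟨x, hx, rfl⟩, _, hk, by simp⟩
  have hpos : ∀ m, 0 < z m := fun m =>
    lt_of_le_of_lt (add_nonneg m.cast_nonneg ha) (hlt m)
  have hz_top : Filter.Tendsto z Filter.atTop Filter.atTop :=
    Filter.tendsto_atTop_mono (fun m => by linarith [hlt m]) tendsto_natCast_atTop_atTop
  -- The target is the limit of points on the segments from `y` to `v + z m • d`, taken with weight
  -- `a / z m → 0`.
  have hlim : Filter.Tendsto (fun m => (1 - a / z m) • y + (a / z m) • v + a • d) Filter.atTop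
      (nhds (y + a • d)) := by
    have h0 : Filter.Tendsto (fun m => a / z m) Filter.atTop (nhds 0) :=
      Filter.Tendsto.const_div_atTop hz_top a
    have := (((tendsto_const_nhds (x := (1 : ℝ))).sub h0).smul_const y).add (h0.smul_const v)
      |>.add_const (a • d)
    simpa using this
  have hclosed : IsClosed P.upperImage := isClosed_closure
  refine hclosed.mem_of_tendsto hlim (Filter.Eventually.of_forall fun m => ?_)
  have hle : a / z m ≤ 1 := by
    rw [div_le_one (hpos m)]
    linarith [hlt m, (m.cast_nonneg : (0 : ℝ) ≤ m)]
  have := hP.convex_upperImage hy (hzm m) (sub_nonneg.2 hle) (div_nonneg ha (hpos m).le)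
    (by ring)
  rwa [smul_add, smul_smul, div_mul_cancel₀ _ (hpos m).ne', ← add_assoc] at this

theorem upperImage_subset_halfspace {w p : L1Space q} (hw : w ∈ dualCone (P.C : Set (L1Space q)))
    (hp : ∀ x ∈ P.X, dot w p ≤ dot w (P.Γ x)) : P.upperImage ⊆ halfspace w p := by
  refine closure_minimal ?_ (isClosed_of_isHPolyhedron (isHPolyhedron_halfspace w p))
  rintro _ ⟨_, ⟨x, hx, rfl⟩, k, hk, rfl⟩
  have h1 := hp x hx
  have h2 := hw k hk
  change 0 ≤ dot w (P.Γ x + k - p)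
  rw [dot_sub, dot_add]
  linarith

theorem isWeakMinimizer_of_P1Optimal {w : L1Space q} {x : EuclideanSpace ℝ (Fin n)}
    (hw : w ∈ dualCone (P.C : Set (L1Space q))) (hw0 : w ≠ 0) (h : P.P1Optimal w x) :
    P.IsWeakMinimizer x := by
  refine ⟨h.1, Set.eq_empty_iff_forall_notMem.2 ?_⟩
  rintro _ ⟨⟨_, rfl, k, hk, hxk⟩, x', hx', rfl⟩
  have h1 := h.2 x' hx'
  rw [← hxk] at h1
  simp only [dot_sub] at h1
  linarith [dot_pos hw hw0 hk]

/-- A strictly dominating point has its constraint slack in `int C`, leaving room to increase `z`.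
-/
theorem isWeakMinimizer_of_P2Optimal {v d : L1Space q} {x : EuclideanSpace ℝ (Fin n)} {z : ℝ}
    (h : P.P2Optimal v d x z) : P.IsWeakMinimizer x := by
  refine ⟨h.1.1, Set.eq_empty_iff_forall_notMem.2 ?_⟩
  rintro _ ⟨⟨_, rfl, k, hk, hxk⟩, x', hx', rfl⟩
  obtain ⟨t, ht, hmem⟩ := exists_pos_add_smul_mem (add_mem_interior_C h.1.2 hk) d
  have hfeas : P.P2Feasible v d x' (z + t) := by
    refine ⟨hx', ?_⟩
    rw [← hxk]
    convert hmem using 1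
    simp only
    module
  linarith [h.2 x' (z + t) hfeas]

/-- Strong duality: under a Slater condition, an optimal solution of the dual supports the upper
image at the value of an optimal solution of the primal. -/
theorem upperImage_subset_of_optimal (hP : P.Regular) {v d w : L1Space q}
    {x : EuclideanSpace ℝ (Fin n)} {z : ℝ} (hx : P.P2Optimal v d x z) (hw : P.D2Optimal v d w)
    {x₀ : EuclideanSpace ℝ (Fin n)} {z₀ : ℝ} (h₀ : P.P2Feasible v d x₀ z₀)
    (hslater : ∀ w ∈ dualCone (P.C : Set (L1Space q)), w ≠ 0 →
      0 < dot w (v + z₀ • d - P.Γ x₀)) :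
    P.upperImage ⊆ halfspace w (P.Γ x) := by
  have hopen : IsOpen (P.Γ '' P.X + interior (P.C : Set (L1Space q))) := isOpen_interior.add_left
  have hconv : Convex ℝ (P.Γ '' P.X + interior (P.C : Set (L1Space q))) :=
    hP.convex_image_add P.C.convex.interior fun _ hk _ hl => add_mem_interior_C hk hl
  -- Membership would allow a larger `z`; hence this point can be separated from the open convex
  -- set.
  have hnot : v + z • d ∉ P.Γ '' P.X + interior (P.C : Set (L1Space q)) := by
    rintro ⟨_, ⟨x', hx', rfl⟩, k, hk, hsum⟩
    obtain ⟨t, ht, hmem⟩ := exists_pos_add_smul_mem hk d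
    have hfeas : P.P2Feasible v d x' (z + t) := by
      refine ⟨hx', ?_⟩
      rw [add_smul, ← add_assoc, ← hsum]
      convert hmem using 1
      simp only
      abel
    linarith [hx.2 x' (z + t) hfeas]
  obtain ⟨f, hf⟩ := geometric_hahn_banach_point_open hconv hopen hnot
  obtain ⟨u, hu⟩ := exists_eq_dot (f : L1Space q →ₗ[ℝ] ℝ)
  have hu' : ∀ y, f y = dot u y := hu
  obtain ⟨k₀, hk₀⟩ := hP.solid_C
  -- Separation extends from `int C` to `C` by letting `t → 0` in `k + t k₀`.
  have hsep : ∀ x' ∈ P.X, ∀ k ∈ P.C, dot u (v + z • d) ≤ dot u (P.Γ x') + dot u k := by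
    intro x' hx' k hk
    refine le_of_forall_pos_le_add fun e he => ?_
    have hlt : ∀ t : ℝ, 0 < t →
        dot u (v + z • d) < dot u (P.Γ x') + dot u k + t * dot u k₀ := by
      intro t ht
      have := hf (P.Γ x' + (k + t • k₀)) ⟨_, ⟨x', hx', rfl⟩, _, add_mem_interior_C hk ?_, rfl⟩
      · rw [hu', hu', dot_add u (P.Γ x'), dot_add u k, dot_smul] at this
        linarith
      · have hsub : t • interior (P.C : Set (L1Space q)) ⊆ P.C := by
          rintro _ ⟨y, hy, rfl⟩
          exact P.C.smul_mem ht (interior_subset hy)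
        exact interior_maximal hsub (isOpen_interior.smul₀ ht.ne') ⟨k₀, hk₀, rfl⟩
    have := hlt (e / (|dot u k₀| + 1)) (by positivity)
    have hb : e / (|dot u k₀| + 1) * dot u k₀ ≤ e := by
      rw [div_mul_eq_mul_div, div_le_iff₀ (by positivity)]
      exact mul_le_mul_of_nonneg_left (by linarith [le_abs_self (dot u k₀)]) he.le
    linarith
  have hudual : u ∈ dualCone (P.C : Set (L1Space q)) := by
    intro k hk
    by_contra! hneg
    have hne : dot u k ≠ 0 := hneg.ne
    have hA := hsep x hx.1.1 0 hP.zero_mem_C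
    have h0 : dot u 0 = 0 := by simp [dot]
    have hB := hsep x hx.1.1 (((dot u (P.Γ x) - dot u (v + z • d) + 1) / (-dot u k)) • k)
      (hP.smul_mem_C (div_nonneg (by linarith) (by linarith)) hk)
    rw [dot_smul] at hB
    have : (dot u (P.Γ x) - dot u (v + z • d) + 1) / (-dot u k) * dot u k =
        -(dot u (P.Γ x) - dot u (v + z • d) + 1) := by field_simp
    linarith
  have hu0 : u ≠ 0 := by
    rintro rfl
    have := hf (P.Γ x + k₀) ⟨_, ⟨x, hx.1.1, rfl⟩, k₀, hk₀, rfl⟩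
    rw [hu', hu'] at this
    simp [dot] at this
  have hsup : ∀ x' ∈ P.X, dot u v + z * dot u d ≤ dot u (P.Γ x') := by
    intro x' hx'
    have h := hsep x' hx' 0 hP.zero_mem_C
    have h0 : dot u 0 = 0 := by simp [dot]
    rw [dot_add, dot_smul] at h
    linarith
  -- The Slater point makes the separating normal non-vertical: `uᵀd ≥ 0` would contradict `z₀ ≤ z`.
  -- Rescaling to `uᵀd = -1` then yields a dual feasible point of value at most `z`.
  have hud : dot u d < 0 := by
    have h1 := hslater u hudual hu0
    rw [dot_sub, dot_add, dot_smul] at h1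
    have h2 := hsup x₀ h₀.1
    have h3 := hx.2 x₀ z₀ h₀
    by_contra! hge
    have := mul_le_mul_of_nonneg_right h3 hge
    linarith
  have hs : 0 < (-dot u d)⁻¹ := inv_pos.2 (by linarith)
  have hfeas : P.D2Feasible d ((-dot u d)⁻¹ • u) := by
    refine ⟨?_, fun k hk => ?_⟩
    · rw [smul_dot]
      have : dot u d ≠ 0 := hud.ne
      field_simp
    · rw [smul_dot]
      exact mul_nonneg hs.le (hudual k hk)
  have hobj : P.D2Objective v w ≤ (z : EReal) := by
    refine (hw.2 _ hfeas).trans ?_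
    have hb : (⨆ x ∈ P.X, ((-dot ((-dot u d)⁻¹ • u) (P.Γ x) : ℝ) : EReal)) ≤
        ((z - dot ((-dot u d)⁻¹ • u) v : ℝ) : EReal) := by
      refine iSup₂_le fun x' hx' => EReal.coe_le_coe_iff.2 ?_
      rw [smul_dot, smul_dot]
      have h1 := mul_le_mul_of_nonneg_left (hsup x' hx') hs.le
      have hne : dot u d ≠ 0 := hud.ne
      have h2 : (-dot u d)⁻¹ * (dot u v + z * dot u d) = (-dot u d)⁻¹ * dot u v - z := by
        field_simp
        ring
      linarith
    refine (add_le_add_left hb _).trans ?_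
    rw [← EReal.coe_add]
    simp
  have hall : ∀ x' ∈ P.X, -dot w (P.Γ x') + dot w v ≤ z := by
    intro x' hx'
    rw [← EReal.coe_le_coe_iff, EReal.coe_add]
    refine le_trans (add_le_add_left ?_ _) hobj
    exact le_iSup₂ (f := fun x (_ : x ∈ P.X) => ((-dot w (P.Γ x) : ℝ) : EReal)) x' hx'
  -- Primal feasibility of `x` and the dual bound give `wᵀΓ(x) ≤ wᵀv - z ≤ wᵀΓ(x')`.
  refine upperImage_subset_halfspace hw.1.2 fun x' hx' => ?_
  have h1 := hall x' hx'
  have h2 := hw.1.2 _ hx.1.2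
  rw [dot_sub, dot_add, dot_smul, hw.1.1] at h2
  linarith

/-- If `w` vanished on the sum of the generators, it would vanish on each of them, hence on `C` and
at `c`. -/
theorem dot_sum_generators_pos {c : L1Space q} {R Rstar : Finset (L1Space q)}
    (hin : P.IsInput c R Rstar) {w : L1Space q} (hw : w ∈ dualCone (P.C : Set (L1Space q)))
    (hw0 : w ≠ 0) : 0 < dot w (∑ d ∈ R, d) := by
  have hR : ∀ d ∈ R, 0 ≤ dot w d := fun d hd => hw d (hin.cone_R ▸ subset_cone _ hd)
  rw [dot_sum]
  refine lt_of_le_of_ne (Finset.sum_nonneg hR) fun h => ?_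
  have hz := (Finset.sum_eq_zero_iff_of_nonneg hR).1 h.symm
  have hsub : cone (R : Set (L1Space q)) ⊆ {y | dot w y = 0} := by
    refine cone_subset (fun d hd => hz d hd) (by simp [dot]) (fun x hx y hy => ?_)
      fun a _ x hx => ?_
    · have hx' : dot w x = 0 := hx
      have hy' : dot w y = 0 := hy
      simp [dot_add, hx', hy']
    · have hx' : dot w x = 0 := hx
      simp [dot_smul, hx']
  have hc : dot w c = 0 := hsub (hin.cone_R ▸ interior_subset hin.c_mem)
  exact (dot_pos hw hw0 hin.c_mem).ne' hc

theorem sum_generators_mem {c : L1Space q} {R Rstar : Finset (L1Space q)}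
    (hin : P.IsInput c R Rstar) : ∑ d ∈ R, d ∈ (P.C : Set (L1Space q)) := by
  rw [← hin.cone_R]
  exact (PointedCone.hull ℝ (R : Set (L1Space q))).sum_mem fun d hd => subset_cone _ hd

/-- The Slater condition for `P₂(v,d)` with `v ∈ Γ(X) + int C`. -/
theorem upperImage_subset_of_sum_generators (hP : P.Regular) {c : L1Space q}
    {R Rstar : Finset (L1Space q)} (hin : P.IsInput c R Rstar) {x₀ : EuclideanSpace ℝ (Fin n)}
    (hx₀ : x₀ ∈ P.X) {d w : L1Space q} {x : EuclideanSpace ℝ (Fin n)} {z : ℝ}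
    (hx : P.P2Optimal (P.Γ x₀ + ∑ d ∈ R, d) d x z)
    (hw : P.D2Optimal (P.Γ x₀ + ∑ d ∈ R, d) d w) : P.upperImage ⊆ halfspace w (P.Γ x) := by
  have e : P.Γ x₀ + ∑ d ∈ R, d + (0 : ℝ) • d - P.Γ x₀ = ∑ d ∈ R, d := by
    rw [zero_smul]; abel
  refine hP.upperImage_subset_of_optimal hx hw (x₀ := x₀) (z₀ := 0) ⟨hx₀, ?_⟩ fun u hu hu0 => ?_
  · rw [e]
    exact sum_generators_mem hin
  · rw [e]
    exact dot_sum_generators_pos hin hu hu0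

/-- The Slater condition for `P₂(v,-c)` with `c ∈ int C`. -/
theorem upperImage_subset_of_neg_interior (hP : P.Regular) {c : L1Space q}
    (hc : c ∈ interior (P.C : Set (L1Space q))) {v w : L1Space q}
    {x : EuclideanSpace ℝ (Fin n)} {z : ℝ} (hx : P.P2Optimal v (-c) x z)
    (hw : P.D2Optimal v (-c) w) : P.upperImage ⊆ halfspace w (P.Γ x) := by
  -- Lowering `z` by one adds `c` to the slack, which makes it a Slater point.
  have e : v + (z - 1) • (-c) - P.Γ x = (v + z • (-c) - P.Γ x) + c := by module
  refine hP.upperImage_subset_of_optimal hx hw (x₀ := x) (z₀ := z - 1) ⟨hx.1.1, ?_⟩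
    fun u hu hu0 => ?_
  · rw [e]
    exact P.C.add_mem hx.1.2 (interior_subset hc)
  · rw [e, dot_add]
    exact add_pos_of_nonneg_of_pos (hu _ hx.1.2) (dot_pos hu hu0 hc)

end Regular

/-! ### The outer approximation of the recession cone -/

/-- The properties of the variables that the first algorithm maintains. -/
structure InitInvariant (P : CVOP n q) (δ : ℝ) (s : InitState n q) : Prop where
  finite_Xbar : s.Xbar.Finite
  weakMinimizer : ∀ x ∈ s.Xbar, P.IsWeakMinimizer x
  isHPolyhedron : IsHPolyhedron s.P0
  upperImage_subset : P.upperImage ⊆ s.P0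
  YIn_subset : s.YIn ⊆ recessionCone P.upperImage ∩ Metric.closedBall 0 1
  Chat_near : ∀ d ∈ s.Chat, ∃ r ∈ s.YIn, ‖d - r‖ ≤ δ

namespace InitInvariant

variable {δ : ℝ} {s : InitState n q}

theorem cut (h : P.InitInvariant δ s) {x : EuclideanSpace ℝ (Fin n)} {w : L1Space q}
    (hx : P.IsWeakMinimizer x) (hw : P.upperImage ⊆ halfspace w (P.Γ x)) (Y : Set (L1Space q)) :
    P.InitInvariant δ { s with
      Xbar := s.Xbar ∪ {x}, P0 := s.P0 ∩ halfspace w (P.Γ x), YOut := Y } where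
  finite_Xbar := h.finite_Xbar.union (Set.finite_singleton x)
  weakMinimizer := by
    rintro y (hy | rfl)
    exacts [h.weakMinimizer y hy, hx]
  isHPolyhedron := h.isHPolyhedron.inter (isHPolyhedron_halfspace _ _)
  upperImage_subset := Set.subset_inter h.upperImage_subset hw
  YIn_subset := h.YIn_subset
  Chat_near := h.Chat_near

theorem insert_YIn (h : P.InitInvariant δ s) {d : L1Space q}
    (hd : d ∈ recessionCone P.upperImage) (hd1 : ‖d‖ = 1) :
    P.InitInvariant δ { s with YIn := s.YIn ∪ {d} } where
  finite_Xbar := h.finite_Xbar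
  weakMinimizer := h.weakMinimizer
  isHPolyhedron := h.isHPolyhedron
  upperImage_subset := h.upperImage_subset
  YIn_subset := by
    rintro y (hy | rfl)
    exacts [h.YIn_subset hy, ⟨hd, by simp [hd1]⟩]
  Chat_near := fun e he => by
    obtain ⟨r, hr, hle⟩ := h.Chat_near e he
    exact ⟨r, Or.inl hr, hle⟩

end InitInvariant

section Run

variable {c : L1Space q} {R Rstar : Finset (L1Space q)} {δ : ℝ}

theorem initInvariant_initialState (hP : P.Regular) (hin : P.IsInput c R Rstar) :
    P.InitInvariant δ (initialState n R) where
  finite_Xbar := Set.finite_empty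
  weakMinimizer := fun _ hx => hx.elim
  isHPolyhedron := isHPolyhedron_univ
  upperImage_subset := Set.subset_univ _
  YIn_subset := fun d hd =>
    ⟨hP.C_subset_recessionCone (hin.cone_R ▸ subset_cone _ hd), by simp [hin.norm_R d hd]⟩
  Chat_near := fun _ hd => hd.elim

theorem BoundednessStep.initInvariant (hin : P.IsInput c R Rstar) {z : L1Space q}
    (hz : z ∈ Rstar) {s s' : InitState n q} (h : P.BoundednessStep z s s')
    (hs : P.InitInvariant δ s) : P.InitInvariant δ s' := by
  have hdual : z ∈ dualCone (P.C : Set (L1Space q)) := hin.cone_Rstar ▸ subset_cone _ hz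
  cases h with
  | unbounded _ =>
    exact ⟨hs.finite_Xbar, hs.weakMinimizer, hs.isHPolyhedron, hs.upperImage_subset,
      hs.YIn_subset, hs.Chat_near⟩
  | solved x hx =>
    refine hs.cut (Regular.isWeakMinimizer_of_P1Optimal hdual ?_ hx)
      (Regular.upperImage_subset_halfspace hdual hx.2) _
    rintro rfl
    simpa [dot] using hin.dot_Rstar 0 hz

/-- The flag never returns to true, so a true flag at the end means that every `z` contributed a
halfspace. -/
theorem P0_subset_halfspace_of_boundednessSteps {S : Finset (L1Space q)} {s s' : InitState n q}
    (h : ForEach P.BoundednessStep S s s') :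
    (s.b = false → s'.b = false) ∧ s'.P0 ⊆ s.P0 ∧
      (s'.b = true → ∀ z ∈ S, ∃ p, s'.P0 ⊆ halfspace z p) := by
  induction h with
  | done s => exact ⟨id, subset_rfl, by simp⟩
  | next z S hz s₁ s₂ s₃ h12 _ ih =>
    obtain ⟨hb, hsub, hhalf⟩ := ih
    cases h12 with
    | unbounded hun =>
      refine ⟨fun _ => hb rfl, hsub, fun htrue => ?_⟩
      rw [hb rfl] at htrue
      exact absurd htrue (by simp)
    | solved x hx =>
      refine ⟨hb, hsub.trans Set.inter_subset_left, fun htrue y hy => ?_⟩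
      rcases Finset.mem_cons.1 hy with rfl | hyS
      · exact ⟨_, hsub.trans Set.inter_subset_right⟩
      · exact hhalf htrue y hyS

theorem LinealityStep.initInvariant (hP : P.Regular) (hin : P.IsInput c R Rstar)
    {x₀ : EuclideanSpace ℝ (Fin n)} (hx₀ : x₀ ∈ P.X) {d : L1Space q} (hd : ‖d‖ = 1)
    {s s' : InitState n q} (h : P.LinealityStep (P.Γ x₀ + ∑ d ∈ R, d) d s s')
    (hs : P.InitInvariant δ s) : P.InitInvariant δ s' := by
  cases h with
  | unbounded hun => exact hs.insert_YIn (hP.mem_recessionCone_of_P2Unbounded hun) hd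
  | solved x z w hx hw =>
    exact hs.cut (Regular.isWeakMinimizer_of_P2Optimal hx)
      (hP.upperImage_subset_of_sum_generators hin hx₀ hx hw) _

theorem DirectionStep.initInvariant (hP : P.Regular) (hin : P.IsInput c R Rstar)
    {x₀ : EuclideanSpace ℝ (Fin n)} (hx₀ : x₀ ∈ P.X)
    {s s' : InitState n q} (h : P.DirectionStep δ (P.Γ x₀ + ∑ d ∈ R, d) s s')
    (hs : P.InitInvariant δ s ∧ s.YOut = outerDirections s.P0) :
    P.InitInvariant δ s' ∧ s'.YOut = outerDirections s'.P0 := by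
  obtain ⟨hs, hY⟩ := hs
  cases h with
  | close d r hd hr _ hle =>
    refine ⟨⟨hs.finite_Xbar, hs.weakMinimizer, hs.isHPolyhedron, hs.upperImage_subset,
      hs.YIn_subset, ?_⟩, hY⟩
    rintro e (he | rfl)
    exacts [hs.Chat_near e he, ⟨r, hr, hle⟩]
  | unbounded d r u lam hd hr _ _ _ _ _ hu0 hun =>
    refine ⟨hs.insert_YIn (smul_mem_recessionCone (by positivity)
      (hP.mem_recessionCone_of_P2Unbounded hun)) ?_, hY⟩
    rw [norm_smul, norm_inv, norm_norm, inv_mul_cancel₀ (norm_ne_zero_iff.2 hu0)]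
  | solved d r u lam x z w _ _ _ _ _ _ _ _ hx hw =>
    exact ⟨hs.cut (Regular.isWeakMinimizer_of_P2Optimal hx)
      (hP.upperImage_subset_of_sum_generators hin hx₀ hx hw) _, rfl⟩

/-- The first algorithm is correct. -/
theorem InitTerminates.correct (hP : P.Regular) (hin : P.IsInput c R Rstar) (hδ : 0 < δ)
    {s : InitState n q} (h : P.InitTerminates R Rstar δ s) :
    P.InitInvariant δ s ∧ s.YOut.Finite ∧ cone s.YOut = recessionCone s.P0 ∧
      P.IsOuterApprox δ s.YOut := by
  obtain ⟨x₀, hx₀, v, rfl, s₁, h₁, hcase⟩ := h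
  have hI₁ : P.InitInvariant δ s₁ := h₁.invariant
    (fun z hz t t' hstep => hstep.initInvariant hin hz) (initInvariant_initialState hP hin)
  rcases hcase with ⟨hb, rfl⟩ | ⟨_, s₂, h₂, h₃, hend⟩
  · have hI : P.InitInvariant δ { s₁ with YOut := R } :=
      ⟨hI₁.finite_Xbar, hI₁.weakMinimizer, hI₁.isHPolyhedron, hI₁.upperImage_subset,
        hI₁.YIn_subset, hI₁.Chat_near⟩
    have hmono : recessionCone P.upperImage ⊆ recessionCone s₁.P0 :=
      recessionCone_mono hP.upperImage_nonempty hI₁.upperImage_subset hI₁.isHPolyhedron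
    -- Each `z ∈ Rstar` is bounded below on `P0`, so `d` is nonnegative against all of `C⁺`.
    have hrec : recessionCone s₁.P0 ⊆ P.C := by
      intro d hd
      refine mem_of_forall_dualCone hP.closed_C hP.zero_mem_C fun z hz => ?_
      have hsub : cone (Rstar : Set (L1Space q)) ⊆ {z | 0 ≤ dot z d} := by
        refine cone_subset (fun z hz => ?_) (by simp [dot]) (fun x hx y hy => ?_)
          fun a ha x hx => ?_
        · obtain ⟨p, hp⟩ := (P0_subset_halfspace_of_boundednessSteps h₁).2.2 hb z hz
          refine nonneg_of_mem_recessionCone (f := dot z) (b := dot z p)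
            (hP.upperImage_nonempty.mono hI₁.upperImage_subset)
            (fun y a e => by rw [dot_add, dot_smul]) (fun y hy => ?_) hd
          have h0 : 0 ≤ dot z (y - p) := hp hy
          rw [dot_sub] at h0
          linarith
        · have hx' : 0 ≤ dot x d := hx
          have hy' : 0 ≤ dot y d := hy
          change 0 ≤ dot (x + y) d
          rw [dot_comm, dot_add, dot_comm d x, dot_comm d y]
          exact add_nonneg hx' hy'
        · change 0 ≤ dot (a • x) d
          rw [smul_dot]
          exact mul_nonneg ha hx
      exact hsub (hin.cone_Rstar ▸ hz)
    have hEq : recessionCone s₁.P0 = P.C :=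
      hrec.antisymm (hP.C_subset_recessionCone.trans hmono)
    have hEq' : recessionCone P.upperImage = P.C :=
      (hmono.trans hrec).antisymm hP.C_subset_recessionCone
    refine ⟨hI, R.finite_toSet, hin.cone_R.trans hEq.symm, ?_⟩
    change P.IsOuterApprox δ (R : Set (L1Space q))
    rw [IsOuterApprox, hEq', hin.cone_R]
    exact ⟨subset_rfl, by rw [Metric.hausdorffDist_self_zero]; exact hδ.le⟩
  · have hI₂ : P.InitInvariant δ s₂ := h₂.invariant (fun d hd t t' hstep =>
      hstep.initInvariant hP hin hx₀ (by
        obtain ⟨e, he, rfl⟩ := Finset.mem_map.1 hd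
        simpa using hin.norm_R e he)) hI₁
    have hI : P.InitInvariant δ s ∧ s.YOut = outerDirections s.P0 := by
      clear hend
      induction h₃ with
      | refl => exact ⟨⟨hI₂.finite_Xbar, hI₂.weakMinimizer, hI₂.isHPolyhedron,
          hI₂.upperImage_subset, hI₂.YIn_subset, hI₂.Chat_near⟩, rfl⟩
      | tail _ hstep ih => exact hstep.initInvariant hP hin hx₀ ih
    obtain ⟨hI, hY⟩ := hI
    have hne := hP.upperImage_nonempty.mono hI.upperImage_subset
    have hcone : cone s.YOut = recessionCone s.P0 := by
      rw [hY, cone_outerDirections hne hI.isHPolyhedron]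
    have hmono : recessionCone P.upperImage ⊆ recessionCone s.P0 :=
      recessionCone_mono hP.upperImage_nonempty hI.upperImage_subset hI.isHPolyhedron
    refine ⟨hI, ?_, hcone, hcone ▸ hmono, ?_⟩
    · rw [hY]
      exact (finite_extremePoints_recessionCone_inter hne hI.isHPolyhedron).subset Set.sdiff_subset
    · rw [hcone]
      refine Metric.hausdorffDist_le_of_mem_dist hδ.le
        (fun y hy => ⟨y, ⟨hmono hy.1, hy.2⟩, by simpa using hδ.le⟩) fun y hy => ?_
      refine exists_dist_le_of_outerDirections hne hI.isHPolyhedron hδ.le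
        ((convex_recessionCone _).inter (convex_closedBall _ _))
        ⟨zero_mem_recessionCone _, by simp⟩ (fun d hd => ?_) hy
      have hd' : d ∈ s.YIn ∪ s.Chat := by
        by_contra hn
        exact (Set.eq_empty_iff_forall_notMem.1 hend) d ⟨hY ▸ hd, hn⟩
      rcases hd' with hd' | hd'
      · exact ⟨d, hI.YIn_subset hd', by simpa using hδ.le⟩
      · obtain ⟨r, hr, hle⟩ := hI.Chat_near d hd'
        exact ⟨r, hI.YIn_subset hr, hle⟩

/-! ### The primal algorithm -/

/-- The properties of the variables that the primal algorithm maintains. -/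
structure MainInvariant (P : CVOP n q) (P0 : Set (L1Space q)) (t : MainState n q) : Prop where
  finite_Xbar : t.Xbar.Finite
  weakMinimizer : ∀ x ∈ t.Xbar, P.IsWeakMinimizer x
  isHPolyhedron : IsHPolyhedron t.Pk
  upperImage_subset : P.upperImage ⊆ t.Pk
  subset_P0 : t.Pk ⊆ P0

variable {ε : ℝ} {P0 : Set (L1Space q)}

theorem VertexStep.mainInvariant (hP : P.Regular)
    (hc : c ∈ interior (P.C : Set (L1Space q))) {v : L1Space q}
    {t t' : MainState n q} (h : P.VertexStep c ε v t t')
    (ht : P.MainInvariant P0 t ∧ IsHPolyhedron t.M ∧ P.upperImage ⊆ t.M) :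
    P.MainInvariant P0 t' ∧ IsHPolyhedron t'.M ∧ P.upperImage ⊆ t'.M := by
  obtain ⟨hI, hM, hPM⟩ := ht
  have hins : ∀ x, P.IsWeakMinimizer x → ∀ M, P.MainInvariant P0
      { t with Xbar := t.Xbar ∪ {x}, M := M } := fun x hx M =>
    ⟨hI.finite_Xbar.union (Set.finite_singleton x), by
      rintro y (hy | rfl)
      exacts [hI.weakMinimizer y hy, hx], hI.isHPolyhedron, hI.upperImage_subset, hI.subset_P0⟩
  cases h with
  | far x z w hx hw _ =>
    exact ⟨hins x (Regular.isWeakMinimizer_of_P2Optimal hx) _,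
      hM.inter (isHPolyhedron_halfspace _ _),
      Set.subset_inter hPM (hP.upperImage_subset_of_neg_interior hc hx hw)⟩
  | near x z w hx hw _ =>
    exact ⟨hins x (Regular.isWeakMinimizer_of_P2Optimal hx) _, hM, hPM⟩

/-- If no vertex is cut off, every vertex is `ε`-close to `Γ(X̄) + C` along `c`. -/
theorem exists_near_of_vertexSteps (hP : P.Regular)
    (hc : c ∈ interior (P.C : Set (L1Space q))) {V : Finset (L1Space q)} {t t' : MainState n q}
    (h : ForEach (P.VertexStep c ε) V t t') :
    t'.Pk = t.Pk ∧ t'.M ⊆ t.M ∧ t.Xbar ⊆ t'.Xbar ∧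
      (t'.M = Set.univ → ∀ v ∈ V, ∃ x ∈ t'.Xbar, v + ε • c - P.Γ x ∈ P.C) := by
  induction h with
  | done t => exact ⟨rfl, subset_rfl, subset_rfl, by simp⟩
  | next v V hv t₁ t₂ t₃ h12 _ ih =>
    obtain ⟨hPk, hM, hX, hnear⟩ := ih
    cases h12 with
    | far x z w hx hw _ =>
      refine ⟨hPk, hM.trans Set.inter_subset_left, Set.subset_union_left.trans hX, fun huniv => ?_⟩
      -- A cut would exclude `Γ x - c`, because `wᵀ(-c) = -1`; so this case cannot leave `M` the
      -- whole space.
      have hmem : P.Γ x + -c ∈ halfspace w (P.Γ x) :=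
        (hM (huniv ▸ Set.mem_univ (P.Γ x + -c))).2
      have h0 : 0 ≤ dot w (P.Γ x + -c - P.Γ x) := hmem
      rw [add_sub_cancel_left, hw.1.1] at h0
      linarith
    | near x z w hx hw hle =>
      refine ⟨hPk, hM, Set.subset_union_left.trans hX, fun huniv y hy => ?_⟩
      rcases Finset.mem_cons.1 hy with rfl | hyV
      · refine ⟨x, hX (Or.inr rfl), ?_⟩
        -- Feasibility of `(x, z)` puts `v - z c - Γ x` in `C`, and `(ε + z) c` is added.
        have := P.C.add_mem hx.1.2 (hP.smul_mem_C (by linarith : 0 ≤ ε + z)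
          (interior_subset hc))
        convert this using 1
        module
      · exact hnear huniv y hyV

/-- The right-hand side is convex and absorbs `cone Y`, so only the points of `V` need checking. -/
theorem upperImage_subset_of_near {V : Finset (L1Space q)} {Xbar : Set (EuclideanSpace ℝ (Fin n))}
    {Y A : Set (L1Space q)} (hV : ∀ v ∈ V, ∃ x ∈ Xbar, v + ε • c - P.Γ x ∈ P.C)
    (hCY : (P.C : Set (L1Space q)) ⊆ cone Y)
    (hA : A ⊆ convexHull ℝ (V : Set (L1Space q)) + cone Y) :
    A ⊆ convexHull ℝ (P.Γ '' Xbar) + cone Y - {ε • c} := by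
  have hconv : Convex ℝ (convexHull ℝ (P.Γ '' Xbar) + cone Y - {ε • c}) :=
    ((convex_convexHull ℝ _).add (convex_cone Y)).sub (convex_singleton _)
  have hsub : convexHull ℝ (V : Set (L1Space q)) ⊆
      convexHull ℝ (P.Γ '' Xbar) + cone Y - {ε • c} := by
    refine convexHull_min (fun v hv => ?_) hconv
    obtain ⟨x, hx, hk⟩ := hV v hv
    exact ⟨_, ⟨_, subset_convexHull ℝ _ ⟨x, hx, rfl⟩, _, hCY hk, rfl⟩, _, rfl, by simp⟩
  intro y hy
  obtain ⟨u, hu, d, hd, rfl⟩ := hA hy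
  obtain ⟨_, ⟨g, hg, e, he, rfl⟩, _, rfl, rfl⟩ := hsub hu
  refine ⟨_, ⟨g, hg, e + d, add_mem_cone he hd, rfl⟩, _, rfl, ?_⟩
  simp only
  abel

theorem MainStep.mainInvariant (hP : P.Regular) (hin : P.IsInput c R Rstar)
    {Y : Set (L1Space q)} (hP0 : IsHPolyhedron P0) (hY : cone Y = recessionCone P0)
    (hCY : (P.C : Set (L1Space q)) ⊆ cone Y) {t t' : MainState n q} (h : P.MainStep c ε t t')
    (ht : P.MainInvariant P0 t) :
    P.MainInvariant P0 t' ∧ (t'.M = Set.univ → t'.Xbar.Nonempty ∧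
      P.upperImage ⊆ convexHull ℝ (P.Γ '' t'.Xbar) + cone Y - {ε • c}) := by
  have hloop : ∀ {V : Finset (L1Space q)} {u : MainState n q},
      ForEach (P.VertexStep c ε) V { t with M := Set.univ } u →
      P.MainInvariant P0 u ∧ IsHPolyhedron u.M ∧ P.upperImage ⊆ u.M := fun h =>
    h.invariant (I := fun u => P.MainInvariant P0 u ∧ IsHPolyhedron u.M ∧ P.upperImage ⊆ u.M)
      (fun v _ _ _ hstep => hstep.mainInvariant hP hin.c_mem)
      ⟨⟨ht.finite_Xbar, ht.weakMinimizer, ht.isHPolyhedron, ht.upperImage_subset, ht.subset_P0⟩,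
        isHPolyhedron_univ, Set.subset_univ _⟩
  cases h with
  | refine s' V _ hV hfor hne =>
    obtain ⟨hI, hM, hPM⟩ := hloop hfor
    exact ⟨⟨hI.finite_Xbar, hI.weakMinimizer, hI.isHPolyhedron.inter hM,
      Set.subset_inter hI.upperImage_subset hPM, Set.inter_subset_left.trans hI.subset_P0⟩,
      fun h => absurd h hne⟩
  | finish _ V _ hV hfor heq =>
    obtain ⟨hI, -, -⟩ := hloop hfor
    obtain ⟨-, -, -, hnear⟩ := exists_near_of_vertexSteps hP hin.c_mem hfor
    have hVne : V.Nonempty := hV.elim (fun h => h.1) fun h => h.1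
    refine ⟨hI, fun _ => ⟨?_, ?_⟩⟩
    · obtain ⟨v, hv⟩ := hVne
      obtain ⟨x, hx, _⟩ := hnear heq v hv
      exact ⟨x, hx⟩
    · refine upperImage_subset_of_near (hnear heq) hCY (ht.upperImage_subset.trans
        ((subset_convexHull_add_recessionCone ht.isHPolyhedron hV).trans
          (Set.add_subset_add_left ?_)))
      rw [hY]
      exact recessionCone_mono (hP.upperImage_nonempty.mono ht.upperImage_subset) ht.subset_P0 hP0

end Run

end CVOP

theorem mainTheorem2 {n q : ℕ} (P : CVOP n q) (hP : P.Regular)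
    (c : L1Space q) (R Rstar : Finset (L1Space q)) (hin : P.IsInput c R Rstar)
    (ε δ : ℝ) (hε : 0 < ε) (hδ : 0 < δ)
    (Xbar : Set (EuclideanSpace ℝ (Fin n))) (YOut : Set (L1Space q))
    (hrun : P.PrimalTerminates c R Rstar ε δ Xbar YOut) :
    P.IsFiniteWeakSolution c ε δ Xbar YOut := by
  obtain ⟨s, hs, rfl, t, ht, hM, rfl⟩ := hrun
  obtain ⟨hI, hfin, hcone, happrox⟩ := hs.correct hP hin hδ
  have hmain : P.MainInvariant s.P0 t ∧ (t.M = Set.univ → t.Xbar.Nonempty ∧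
      P.upperImage ⊆ convexHull ℝ (P.Γ '' t.Xbar) + cone s.YOut - {ε • c}) := by
    clear hM
    induction ht with
    | refl =>
      exact ⟨⟨hI.finite_Xbar, hI.weakMinimizer, hI.isHPolyhedron, hI.upperImage_subset,
        -- The initial `M = ∅` is not the whole space, so termination forces at least one round.
        subset_rfl⟩, fun h => absurd h Set.empty_ne_univ⟩
    | tail _ hstep ih =>
      exact hstep.mainInvariant hP hin hI.isHPolyhedron hcone
        (hP.C_subset_recessionCone.trans happrox.1) ih.1
  exact ⟨hmain.1.finite_Xbar, hfin, (hmain.2 hM).1, hmain.1.weakMinimizer, happrox,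
    (hmain.2 hM).2⟩
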